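/- Let $H_0,H_1,\dots,H_m$ be Hermitian $n\times n$ matrices, $S_k=-\iota H_k$, and assume that the system $\dot X=(S_0+\sum_{k=1}^m u_k(t)S_k)X$ on $\mathrm U(n)$ is controllable, i.e. every $X_f\in \mathrm U(n)$ is reached from the identity in some finite time by some admissible control (bounded and right-continuous, in particular continuous or piecewise constant). Given $T_f>0$, a gain $K>0$, an $n\times\bar n$ matrix $E$ with $E^\dagger E=I$ and reference inputs $\bar u_k:[0,T_f]\to\mathbb R$, a reference trajectory is a solution $\overline X:[0,T_f]\to \mathrm U(n)$ of $\dot{\overline X}=(S_0+\sum_k\bar u_kS_k)\overline X$, $\overline X(0)=\overline X_0$. Put $\mathcal V(\widetilde X)=2\bar n-2\Re\,\mathrm{trace}(E^\dagger\widetilde XE)$ and $\widetilde S_k(t)=\overline X^\dagger(t)S_k\overline X(t)$. The closed loop system is $\dot{\widetilde X}=\big(\sum_k\widetilde u_k\widetilde S_k\big)\widetilde X$ with $\widetilde u_k=-K\,\nabla_{\widetilde X}\mathcal V\cdot(\widetilde S_k\widetilde X)=2K\,\Re\,\mathrm{trace}(E^\dagger\widetilde S_k\widetilde XE)$. For $\lambda\in(0,1)$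 the trajectory $\overline X$ is called $\lambda$-attractive in $\overline{\mathcal B}_c(I)=\{Y\in \mathrm U(n):\|(Y-I)E\|\le c\}$ (Frobenius norm) if for every $X_0\in \mathrm U(n)$ with $\widetilde X_0=\overline X(0)^\dagger X_0\in\overline{\mathcal B}_c(I)$ the solution of the closed loop system with $\widetilde X(0)=\widetilde X_0$ satisfies $\mathcal V(\widetilde X(T_f))\le\lambda\,\mathcal V(\widetilde X(0))$. Then there exist $M_0\in\mathbb N$ and a nonzero real polynomial $Q$ in the variables $u_k^{(j)}$, $1\le k\le m$, $0\le j\le M_0$, depending only on $H_0,\dots,H_m$, such that the following holds. (a) Let $E$ be an $n\times\bar n$ matrix with $E^\dagger E=I$, where either $\bar n<n$, or some control Hamiltonian $H_k$ with $k\geq 1$ has nonzero trace. Let $K>0$, $0<c<2$ and $T_f>0$. If the reference inputs are of class $C^{M_0}$ on $[0,T_f]$ and do not satisfy the differential equation $Q(\bar u_k^{(j)}(t))=0$ identically on $[0,T_f]$, then there is $\lambda\in(0,1)$ such that, for every $\overline X_0\in \mathrm U(n)$, the reference trajectory with $\overline X(0)=\overline X_0$ is $\lambda$-attractive in $\overline{\mathcal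 B}_c(I)$. In particular, this property holds with probability one with respect to the $M_0$-jet of the reference inputs: for every absolutely continuous probability law on $\mathbb R^{m(M_0+1)}$ and almost every $v$, it holds for all reference inputs of class $C^{M_0}$ on $[0,T_f]$ whose $M_0$-jet at some time $t_0\in[0,T_f]$ is $v$. (b) Let $T_f,T>0$, $M\ge M_0$, and let $\mathbb W$ be a window function of class $C^{M_0}$ on $[0,T_f]$ that does not vanish identically there (for instance $\mathbb W\equiv1$, or $\mathbb W(t)=\tfrac12(1-\cos(2\pi t/T_f))$). If the coefficients $(\mathbf a,\mathbf b)\in\mathbb R^{mM}\times\mathbb R^{mM}$ are random with an absolutely continuous law, then with probability one the reference inputs $$\bar u_k(t)=\mathbb W(t)\sum_{\ell=1}^M\big[a_{k\ell}\sin(2\ell\pi t/T)+b_{k\ell}\cos(2\ell\pi t/T)\big],\qquad k=1,\dots,m,$$ do not satisfy $Q=0$ identically on $[0,T_f]$. -/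

import Mathlib

open MeasureTheory Set Matrix

noncomputable section

namespace QuantumControl

/-- The skew-Hermitian matrix `S = -i H` attached to a Hamiltonian `H`. -/
def skew {n : ℕ} (H : Matrix (Fin n) (Fin n) ℂ) : Matrix (Fin n) (Fin n) ℂ :=
  -(Complex.I • H)

/-- The right-hand side matrix `S₀ + ∑ₖ vₖ Sₖ`, where `Sₖ = -i Hₖ`, for the control value `v`. -/
def generator {n m : ℕ} (H₀ : Matrix (Fin n) (Fin n) ℂ) (H : Fin m → Matrix (Fin n) (Fin n) ℂ)
    (v : Fin m → ℝ) : Matrix (Fin n) (Fin n) ℂ :=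
  skew H₀ + ∑ k, v k • skew (H k)

/-- Controllability on `U(n)`: every unitary matrix is reached from the identity, in some finite
time, by an admissible control. Admissible controls are bounded and continuous from the right
(for instance continuous ones, or piecewise constant ones); the trajectory is continuous and
satisfies `X' = (S₀ + ∑ₖ uₖ Sₖ) X` with derivatives from the right, so that jumps of `u` are
allowed. -/
def Controllable {n m : ℕ} (H₀ : Matrix (Fin n) (Fin n) ℂ)
    (H : Fin m → Matrix (Fin n) (Fin n) ℂ) : Prop :=
  ∀ X_f : Matrix.unitaryGroup (Fin n) ℂ,
    ∃ (T : ℝ) (u : Fin m → ℝ → ℝ) (X : ℝ → Matrix.unitaryGroup (Fin n) ℂ),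
      0 ≤ T ∧
      (∃ B : ℝ, ∀ k, ∀ t ∈ Icc 0 T, |u k t| ≤ B) ∧
      (∀ k, ∀ t ∈ Ico 0 T, ContinuousWithinAt (u k) (Ici t) t) ∧
      ContinuousOn X (Icc 0 T) ∧
      (∀ t ∈ Ico 0 T,
        HasDerivWithinAt (fun s => (X s : Matrix (Fin n) (Fin n) ℂ))
          (generator H₀ H (fun k => u k t) * (X t : Matrix (Fin n) (Fin n) ℂ)) (Ici t) t) ∧
      X 0 = 1 ∧ X T = X_f

/-- `Xbar` is the reference trajectory on `[0, T]` for the reference input `u`, with initial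
condition `Xbar₀`. -/
def IsReferenceTrajectory {n m : ℕ} (H₀ : Matrix (Fin n) (Fin n) ℂ)
    (H : Fin m → Matrix (Fin n) (Fin n) ℂ) (T : ℝ) (u : Fin m → ℝ → ℝ)
    (Xbar₀ : Matrix.unitaryGroup (Fin n) ℂ) (Xbar : ℝ → Matrix.unitaryGroup (Fin n) ℂ) : Prop :=
  Xbar 0 = Xbar₀ ∧
    ∀ t ∈ Icc 0 T,
      HasDerivWithinAt (fun s => (Xbar s : Matrix (Fin n) (Fin n) ℂ))
        (generator H₀ H (fun k => u k t) * (Xbar t : Matrix (Fin n) (Fin n) ℂ)) (Icc 0 T) t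

/-- The partial trace Lyapunov function `V(X) = 2 d - 2 Re tr(E† X E)`. -/
def lyapunov {n d : ℕ} (E : Matrix (Fin n) (Fin d) ℂ) (X : Matrix (Fin n) (Fin n) ℂ) : ℝ :=
  2 * (d : ℝ) - 2 * (Matrix.trace (Eᴴ * X * E)).re

/-- The matrix `Xbar† S Xbar`, for `S = -i H`. -/
def skewTilde {n : ℕ} (H : Matrix (Fin n) (Fin n) ℂ) (Xbar : Matrix.unitaryGroup (Fin n) ℂ) :
    Matrix (Fin n) (Fin n) ℂ :=
  (Xbar : Matrix (Fin n) (Fin n) ℂ)ᴴ * skew H * (Xbar : Matrix (Fin n) (Fin n) ℂ)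

/-- The Lyapunov feedback `-K (∇V(Xt) · (Stilde Xt))`, where `∇V(Xt) · D` is the derivative of `V`
at `Xt` in the direction `D`. -/
def feedback {n d : ℕ} (E : Matrix (Fin n) (Fin d) ℂ) (K : ℝ) (Stilde Xt : Matrix (Fin n) (Fin n) ℂ) :
    ℝ :=
  -K * lineDeriv ℝ (lyapunov E) Xt (Stilde * Xt)

/-- The feedback of the partial trace Lyapunov function in closed form. -/
theorem feedback_eq {n d : ℕ} (E : Matrix (Fin n) (Fin d) ℂ) (K : ℝ)
    (Stilde Xt : Matrix (Fin n) (Fin n) ℂ) :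
    feedback E K Stilde Xt = 2 * K * (Matrix.trace (Eᴴ * Stilde * Xt * E)).re := by
  have h : (fun t : ℝ => lyapunov E (Xt + t • (Stilde * Xt))) =
      fun t : ℝ => lyapunov E Xt + t * (-2 * (Matrix.trace (Eᴴ * Stilde * Xt * E)).re) := by
    funext t
    simp only [lyapunov, Matrix.mul_add, Matrix.add_mul, Matrix.mul_smul, Matrix.smul_mul,
      Matrix.trace_add, Matrix.trace_smul, Complex.add_re, Complex.real_smul,
      Complex.re_ofReal_mul, Matrix.mul_assoc]
    ring
  rw [feedback, lineDeriv, h]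
  simp
  ring

/-- `Xt` is the solution on `[0, T]`, with initial condition `Xt₀`, of the closed loop system
`Xt' = (∑ₖ utₖ Stₖ) Xt`, where `Stₖ = Xbar† Sₖ Xbar` and `utₖ` is the Lyapunov feedback. -/
def IsClosedLoopTrajectory {n m d : ℕ} (H : Fin m → Matrix (Fin n) (Fin n) ℂ)
    (E : Matrix (Fin n) (Fin d) ℂ) (K T : ℝ) (Xbar : ℝ → Matrix.unitaryGroup (Fin n) ℂ)
    (Xt₀ : Matrix.unitaryGroup (Fin n) ℂ) (Xt : ℝ → Matrix.unitaryGroup (Fin n) ℂ) : Prop :=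
  Xt 0 = Xt₀ ∧
    ∀ t ∈ Icc 0 T,
      HasDerivWithinAt (fun s => (Xt s : Matrix (Fin n) (Fin n) ℂ))
        ((∑ k, feedback E K (skewTilde (H k) (Xbar t)) (Xt t) • skewTilde (H k) (Xbar t)) *
          (Xt t : Matrix (Fin n) (Fin n) ℂ)) (Icc 0 T) t

/-- The partial distance `‖(X - Y) E‖`, with the Frobenius norm. -/
def pdist {n d : ℕ} (E : Matrix (Fin n) (Fin d) ℂ) (X Y : Matrix.unitaryGroup (Fin n) ℂ) : ℝ :=
  Real.sqrt (∑ i, ∑ j,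
    ‖(((X : Matrix (Fin n) (Fin n) ℂ) - (Y : Matrix (Fin n) (Fin n) ℂ)) * E) i j‖ ^ 2)

/-- The closed ball of `U(n)` for the partial distance. -/
def partialBall {n d : ℕ} (E : Matrix (Fin n) (Fin d) ℂ) (X : Matrix.unitaryGroup (Fin n) ℂ)
    (c : ℝ) : Set (Matrix.unitaryGroup (Fin n) ℂ) :=
  {Y | pdist E Y X ≤ c}

/-- The reference trajectory `Xbar` on `[0, T]` is `lam`-attractive in the closed ball of radius `c`
centred at the identity. -/
def IsAttractive {n m d : ℕ} (H : Fin m → Matrix (Fin n) (Fin n) ℂ)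
    (E : Matrix (Fin n) (Fin d) ℂ) (K T c lam : ℝ)
    (Xbar : ℝ → Matrix.unitaryGroup (Fin n) ℂ) : Prop :=
  ∀ X₀ : Matrix.unitaryGroup (Fin n) ℂ,
    (Xbar 0)⁻¹ * X₀ ∈ partialBall E 1 c →
    ∀ Xt : ℝ → Matrix.unitaryGroup (Fin n) ℂ,
      IsClosedLoopTrajectory H E K T Xbar ((Xbar 0)⁻¹ * X₀) Xt →
      lyapunov E (Xt T) ≤ lam * lyapunov E (Xt 0)

/-- There is one `lam ∈ (0,1)` such that, for every initial condition, the reference trajectory of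
the input `u` is `lam`-attractive in the closed ball of radius `c` centred at the identity. -/
def UniformlyAttractive {n m d : ℕ} (H₀ : Matrix (Fin n) (Fin n) ℂ)
    (H : Fin m → Matrix (Fin n) (Fin n) ℂ) (E : Matrix (Fin n) (Fin d) ℂ) (K T c : ℝ)
    (u : Fin m → ℝ → ℝ) : Prop :=
  ∃ lam ∈ Ioo (0 : ℝ) 1, ∀ (Xbar₀ : Matrix.unitaryGroup (Fin n) ℂ)
    (Xbar : ℝ → Matrix.unitaryGroup (Fin n) ℂ),
    IsReferenceTrajectory H₀ H T u Xbar₀ Xbar → IsAttractive H E K T c lam Xbar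

/-- The jet of order `M₀` at time `t` of an input defined on `[0, T]`. -/
def inputJet {m : ℕ} (M₀ : ℕ) (T : ℝ) (u : Fin m → ℝ → ℝ) (t : ℝ) :
    Fin m × Fin (M₀ + 1) → ℝ :=
  fun p => iteratedDerivWithin (p.2 : ℕ) (u p.1) (Icc 0 T) t

/-- The input `u` is a solution on `[0, T]` of the differential equation
`Q(uₖ⁽ʲ⁾(t) : k, 0 ≤ j ≤ M₀) = 0`. -/
def SolvesDiffPoly {m M₀ : ℕ} (Q : MvPolynomial (Fin m × Fin (M₀ + 1)) ℝ) (T : ℝ)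
    (u : Fin m → ℝ → ℝ) : Prop :=
  ∀ t ∈ Icc 0 T, MvPolynomial.eval (inputJet M₀ T u t) Q = 0

/-- The seed input: the window function `w` times the sum of the harmonics `1, …, M`,
`∑ₗ aₖₗ sin(2 l π t / P) + bₖₗ cos(2 l π t / P)`, of period `P`. -/
def seedInput {m M : ℕ} (w : ℝ → ℝ) (P : ℝ) (ab : (Fin m → Fin M → ℝ) × (Fin m → Fin M → ℝ)) :
    Fin m → ℝ → ℝ :=
  fun k t => w t * ∑ l : Fin M,
    (ab.1 k l * Real.sin (2 * ((l : ℕ) + 1 : ℝ) * Real.pi * t / P) +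
      ab.2 k l * Real.cos (2 * ((l : ℕ) + 1 : ℝ) * Real.pi * t / P))

end QuantumControl

end

open QuantumControl

noncomputable section

set_option linter.unusedSectionVars false

namespace QuantumControl

/-! The core is a statement about generic inputs. Over the domain of polynomials in the jet
variables, let `D w = w' + A w` with `A = a₀ + ∑ uₖ aₖ`, where `a₀` and `aₖ` are the brackets with
`S₀` and `Sₖ` in coordinates, and saturate the module generated by all `Dʲ Sₖ` (`iterModule`). Its
rank is finite, so finitely many generators suffice, and the module is stable under `∂/∂uₖ⁽ʲ⁾` for
large `j`. Since `[∂/∂uₖ⁽ʲ⁺¹⁾, D] = ∂/∂uₖ⁽ʲ⁾`, this stability descends to every `j`; since `[∂/∂uₖ,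
D] = aₖ`, the module is stable under `aₖ`. The constant vectors of the module therefore form a space
that contains the `Sₖ` and is closed under the brackets with `S₀` and the `Sₖ`. Clearing
denominators gives a polynomial off whose zero set finitely many evaluated `Dʲ Sₖ` span this space
(`exists_generic_polynomial`).

Controllability makes the space large: closure under brackets becomes closure under unitary
conjugation, so the space contains every traceless skew-Hermitian matrix, and every skew-Hermitian
one if some `Hₖ` has nonzero trace (`skew_mem_of_controllable`). Along a reference trajectory,
differentiating `X† B X` produces `X† (B' + [B, S₀ + ∑ uₖ Sₖ]) X`. A linear form that kills all `X†
Sₖ X` thus kills the conjugates of all `Dʲ Sₖ` at a jet with `Q ≠ 0`, hence vanishes on that large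
space (`exists_observability_polynomial`).

Compactness turns this observability into a coercive Gramian, with a constant independent of the
initial condition because two reference trajectories differ by a constant right factor. The closed
loop gives `V' = -4K ∑ yₖ²`. If `V` drops little, the state hardly moves, so the drop dominates the
output energy of the frozen initial state (`frozen_energy_le`), which is the Gramian at the skew
part of `X E E†`, after removal of the trace if necessary. That matrix has squared norm at least a
constant times `V`, because `c < 2` keeps `V` below `4` (`exists_skew_representative`). Hence `V`
decreases by a fixed factor.

The probabilistic claims hold because the zero set of a nonzero polynomial is null. For seeds, the
jet at a time where the window is nonzero is a surjective linear function of the coefficients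
(`seedJet_surjective`), so null sets pull back to null sets. -/

/-! ### Saturated submodules over a domain -/

section Saturation

variable {R : Type*} [CommRing R] [IsDomain R] {ι : Type*}

/-- The saturation of the span of a set `G` of vectors over a domain. -/
def saturation (G : Set (ι → R)) : Submodule R (ι → R) where
  carrier := {w | ∃ q : R, q ≠ 0 ∧ q • w ∈ Submodule.span R G}
  zero_mem' := ⟨1, one_ne_zero, by simp⟩
  add_mem' := by
    rintro v w ⟨p, hp, hv⟩ ⟨q, hq, hw⟩
    refine ⟨p * q, mul_ne_zero hp hq, ?_⟩
    rw [smul_add]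
    refine add_mem ?_ ?_
    · rw [mul_comm, mul_smul]
      exact Submodule.smul_mem _ _ hv
    · rw [mul_smul]
      exact Submodule.smul_mem _ _ hw
  smul_mem' := by
    rintro c w ⟨q, hq, hw⟩
    refine ⟨q, hq, ?_⟩
    rw [smul_comm]
    exact Submodule.smul_mem _ _ hw

theorem mem_saturation {G : Set (ι → R)} {w : ι → R} :
    w ∈ saturation G ↔ ∃ q : R, q ≠ 0 ∧ q • w ∈ Submodule.span R G := Iff.rfl

theorem span_le_saturation (G : Set (ι → R)) : Submodule.span R G ≤ saturation G :=
  fun w hw => ⟨1, one_ne_zero, by simpa using hw⟩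

theorem subset_saturation (G : Set (ι → R)) : G ⊆ saturation G :=
  fun _ hw => span_le_saturation G (Submodule.subset_span hw)

theorem mem_saturation_of_smul_mem {G : Set (ι → R)} {q : R} (hq : q ≠ 0) {w : ι → R}
    (h : q • w ∈ saturation G) : w ∈ saturation G := by
  obtain ⟨p, hp, hw⟩ := h
  exact ⟨p * q, mul_ne_zero hp hq, by rwa [mul_smul]⟩

theorem saturation_le {G G' : Set (ι → R)} (h : G ⊆ saturation G') :
    saturation G ≤ saturation G' := by
  rintro w ⟨q, hq, hw⟩
  exact mem_saturation_of_smul_mem hq (Submodule.span_le.2 h hw)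

/-- An operator satisfying the Leibniz rule preserves a saturated module as soon as it maps the
generators into it. -/
theorem saturation_stable {G : Set (ι → R)} (δ : R → R) (T : (ι → R) → (ι → R))
    (hadd : ∀ v w, T (v + w) = T v + T w)
    (hsmul : ∀ (c : R) w, T (c • w) = δ c • w + c • T w)
    (hG : ∀ g ∈ G, T g ∈ saturation G) {w : ι → R} (hw : w ∈ saturation G) :
    T w ∈ saturation G := by
  have hT0 : T 0 = 0 := by simpa using hadd 0 0
  have hspan : ∀ v ∈ Submodule.span R G, T v ∈ saturation G := by
    intro v hv
    induction hv using Submodule.span_induction with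
    | mem x hx => exact hG x hx
    | zero => rw [hT0]; exact zero_mem _
    | add x y _ _ hx hy => rw [hadd]; exact add_mem hx hy
    | smul c x hx hTx =>
      rw [hsmul]
      exact add_mem (Submodule.smul_mem _ _ (span_le_saturation G hx))
        (Submodule.smul_mem _ _ hTx)
  obtain ⟨q, hq, hqw⟩ := hw
  -- By Leibniz `T (q • w) = δ q • w + q • T w`. The first summand is already in the saturation
  -- because `w` is, so `q • T w` is too, and `q` cancels.
  have h := hspan _ hqw
  rw [hsmul] at h
  have h1 : δ q • w ∈ saturation G := Submodule.smul_mem _ _ ⟨q, hq, hqw⟩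
  exact mem_saturation_of_smul_mem hq ((Submodule.add_mem_iff_right _ h1).1 h)

/-- The saturation of the span of a family is that of a finite subfamily. -/
theorem exists_finite_saturation_eq [Finite ι] {α : Type*} (f : α → ι → R) :
    ∃ s : Set α, s.Finite ∧ saturation (Set.range f) = saturation (f '' s) := by
  -- Maximality says that each remaining `f a` has a nonzero multiple in the span of the chosen
  -- ones, which is membership in the saturation. The finite rank of `ι → R` bounds the subfamily.
  obtain ⟨s, hs, hmax⟩ := exists_maximal_linearIndepOn R f
  have : Fintype ι := Fintype.ofFinite ι
  refine ⟨s, ?_, le_antisymm (saturation_le ?_) (saturation_le ?_)⟩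
  · have h := LinearIndependent.cardinal_lift_le_rank (R := R) hs
    have h2 : Module.rank R (ι → R) < Cardinal.aleph0 := Module.rank_lt_aleph0 R _
    have h3 := h.trans_lt (Cardinal.lift_lt_aleph0.2 h2)
    rw [Cardinal.lift_lt_aleph0, Cardinal.lt_aleph0_iff_finite] at h3
    exact Set.toFinite s
  · rintro _ ⟨a, rfl⟩
    by_cases ha : a ∈ s
    · exact subset_saturation _ ⟨a, ha, rfl⟩
    · exact hmax a ha
  · rintro _ ⟨a, -, rfl⟩
    exact subset_saturation _ ⟨a, rfl⟩

end Saturation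

/-! ### Iterated brackets along a generic input -/

section Generic

variable {κ ι : Type*} [Fintype κ] [Fintype ι]

/-- Polynomials in the jet variables `u_k^{(j)}`. -/
abbrev JetPoly (κ : Type*) : Type _ := MvPolynomial (κ × ℕ) ℝ

/-- The total time derivative, `u_k^{(j)} ↦ u_k^{(j+1)}`. -/
def totalDeriv (κ : Type*) : Derivation ℝ (JetPoly κ) (JetPoly κ) :=
  MvPolynomial.mkDerivation ℝ fun p => MvPolynomial.X (p.1, p.2 + 1)

@[simp]
theorem totalDeriv_X (p : κ × ℕ) :
    totalDeriv κ (MvPolynomial.X p) = MvPolynomial.X (p.1, p.2 + 1) := by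
  simp [totalDeriv]

/-- The matrix `a₀ + ∑ₖ uₖ aₖ` over the ring of jet polynomials. -/
def driftMatrix (a₀ : Matrix ι ι ℝ) (a : κ → Matrix ι ι ℝ) : Matrix ι ι (JetPoly κ) :=
  a₀.map MvPolynomial.C + ∑ k, (MvPolynomial.X (k, 0) : JetPoly κ) • (a k).map MvPolynomial.C

/-- The operator `w ↦ w' + (a₀ + ∑ₖ uₖ aₖ) w`. -/
def covDeriv (a₀ : Matrix ι ι ℝ) (a : κ → Matrix ι ι ℝ) (w : ι → JetPoly κ) : ι → JetPoly κ :=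
  (fun i => totalDeriv κ (w i)) + driftMatrix a₀ a *ᵥ w

/-- The iterates of `covDeriv` on the constant vectors `s k`. -/
def iterVec (a₀ : Matrix ι ι ℝ) (a : κ → Matrix ι ι ℝ) (s : κ → ι → ℝ) (k : κ) :
    ℕ → ι → JetPoly κ
  | 0 => fun i => MvPolynomial.C (s k i)
  | j + 1 => covDeriv a₀ a (iterVec a₀ a s k j)

/-- The polynomials in the jet variables of order less than `N`. -/
def jetSubalgebra (κ : Type*) (N : ℕ) : Subalgebra ℝ (JetPoly κ) :=
  MvPolynomial.supported ℝ {p : κ × ℕ | p.2 < N}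

theorem jetSubalgebra_mono {N N' : ℕ} (h : N ≤ N') : jetSubalgebra κ N ≤ jetSubalgebra κ N' :=
  MvPolynomial.supported_mono fun _ hp => lt_of_lt_of_le hp h

theorem X_mem_jetSubalgebra {N : ℕ} {p : κ × ℕ} (h : p.2 < N) :
    MvPolynomial.X p ∈ jetSubalgebra κ N :=
  MvPolynomial.X_mem_supported.2 h

theorem exists_mem_jetSubalgebra (f : JetPoly κ) : ∃ N, f ∈ jetSubalgebra κ N := by
  refine ⟨(f.vars.sup fun p => p.2) + 1, ?_⟩
  rw [jetSubalgebra, MvPolynomial.mem_supported]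
  intro p hp
  exact Nat.lt_succ_of_le (Finset.le_sup (f := fun p : κ × ℕ => p.2) hp)

theorem totalDeriv_mem {N : ℕ} {f : JetPoly κ} (hf : f ∈ jetSubalgebra κ N) :
    totalDeriv κ f ∈ jetSubalgebra κ (N + 1) := by
  have hmono := jetSubalgebra_mono (κ := κ) (Nat.le_succ N)
  rw [jetSubalgebra, MvPolynomial.supported] at hf
  induction hf using Algebra.adjoin_induction with
  | mem x hx =>
    obtain ⟨p, hp, rfl⟩ := hx
    rw [totalDeriv_X]
    exact X_mem_jetSubalgebra (Nat.succ_lt_succ hp)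
  | algebraMap r => simp
  | add x y _ _ hx hy => rw [map_add]; exact add_mem hx hy
  | mul x y hx hy hx' hy' =>
    rw [Derivation.leibniz]
    exact add_mem (mul_mem (hmono hx) hy') (mul_mem (hmono hy) hx')

theorem pderiv_eq_zero_of_mem {N : ℕ} {f : JetPoly κ} (hf : f ∈ jetSubalgebra κ N) {p : κ × ℕ}
    (hp : N ≤ p.2) : MvPolynomial.pderiv p f = 0 := by
  refine MvPolynomial.pderiv_eq_zero_of_notMem_vars fun h => ?_
  exact absurd (MvPolynomial.mem_supported.1 hf h) (not_lt.2 hp)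

variable (a₀ : Matrix ι ι ℝ) (a : κ → Matrix ι ι ℝ) (s : κ → ι → ℝ)

theorem driftMatrix_mem (i j : ι) : driftMatrix a₀ a i j ∈ jetSubalgebra κ 1 := by
  simp only [driftMatrix, Matrix.add_apply, Matrix.sum_apply, Matrix.smul_apply, Matrix.map_apply,
    smul_eq_mul]
  refine add_mem (Subalgebra.algebraMap_mem _ _) (sum_mem fun k _ => mul_mem ?_ ?_)
  · exact X_mem_jetSubalgebra (by simp)
  · exact Subalgebra.algebraMap_mem _ _

/-- Each application of `covDeriv` raises the jet order by at most one. This count decides which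
partial derivatives kill a generator and how many derivatives of the input are needed. -/
theorem iterVec_mem (k : κ) (j : ℕ) (i : ι) : iterVec a₀ a s k j i ∈ jetSubalgebra κ j := by
  induction j generalizing i with
  | zero => exact Subalgebra.algebraMap_mem _ _
  | succ j ih =>
    refine add_mem (totalDeriv_mem (ih i)) (sum_mem fun i' _ => mul_mem ?_ ?_)
    · exact jetSubalgebra_mono (by omega) (driftMatrix_mem a₀ a i i')
    · exact jetSubalgebra_mono (by omega) (ih i')

theorem covDeriv_add (v w : ι → JetPoly κ) :
    covDeriv a₀ a (v + w) = covDeriv a₀ a v + covDeriv a₀ a w := by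
  simp only [covDeriv, Matrix.mulVec_add]
  ext1 i
  simp only [Pi.add_apply, map_add]
  ring

theorem covDeriv_smul (c : JetPoly κ) (w : ι → JetPoly κ) :
    covDeriv a₀ a (c • w) = totalDeriv κ c • w + c • covDeriv a₀ a w := by
  simp only [covDeriv, Matrix.mulVec_smul]
  ext1 i
  simp only [Pi.add_apply, Pi.smul_apply, smul_eq_mul, Derivation.leibniz]
  ring

/-- The saturated module generated by the iterated vectors. -/
def iterModule : Submodule (JetPoly κ) (ι → JetPoly κ) :=
  saturation (Set.range fun p : κ × ℕ => iterVec a₀ a s p.1 p.2)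

theorem iterVec_mem_iterModule (k : κ) (j : ℕ) : iterVec a₀ a s k j ∈ iterModule a₀ a s :=
  subset_saturation _ ⟨(k, j), rfl⟩

theorem covDeriv_mem_iterModule {w : ι → JetPoly κ} (hw : w ∈ iterModule a₀ a s) :
    covDeriv a₀ a w ∈ iterModule a₀ a s := by
  refine saturation_stable (totalDeriv κ) (covDeriv a₀ a) (covDeriv_add a₀ a)
    (covDeriv_smul a₀ a) ?_ hw
  rintro _ ⟨p, rfl⟩
  exact iterVec_mem_iterModule a₀ a s p.1 (p.2 + 1)

/-- The saturation is that of finitely many generators, which involve only jets of bounded order. A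
derivation in a variable of higher order kills them all, so Leibniz and saturation give stability.
-/
theorem exists_pderiv_mem_iterModule :
    ∃ N : ℕ, ∀ p : κ × ℕ, N ≤ p.2 → ∀ w ∈ iterModule a₀ a s,
      (fun i => MvPolynomial.pderiv p (w i)) ∈ iterModule a₀ a s := by
  obtain ⟨t, ht, heq⟩ := exists_finite_saturation_eq
    fun p : κ × ℕ => iterVec a₀ a s p.1 p.2
  refine ⟨ht.toFinset.sup fun p => p.2, fun p hp w hw => ?_⟩
  rw [iterModule, heq] at hw ⊢
  refine saturation_stable (MvPolynomial.pderiv p)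
    (fun w i => MvPolynomial.pderiv p (w i)) ?_ ?_ ?_ hw
  · intro v w
    ext1 i
    simp
  · intro c w
    ext1 i
    simp only [Pi.add_apply, Pi.smul_apply, smul_eq_mul, Derivation.leibniz]
    ring
  · rintro _ ⟨q, hq, rfl⟩
    have hle : q.2 ≤ p.2 :=
      (Finset.le_sup (f := fun p : κ × ℕ => p.2) (ht.mem_toFinset.2 hq)).trans hp
    have h0 : (fun i => MvPolynomial.pderiv p (iterVec a₀ a s q.1 q.2 i)) = 0 := by
      ext1 i
      exact pderiv_eq_zero_of_mem (iterVec_mem a₀ a s q.1 q.2 i) hle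
    rw [h0]
    exact zero_mem _

/-- Both sides of the commutator identity `[∂/∂uₖ⁽ʲ⁺¹⁾, d/dt] = ∂/∂uₖ⁽ʲ⁾` are derivations, so it
suffices to compare them on the variables. -/
theorem pderiv_totalDeriv_succ (k : κ) (j : ℕ) (f : JetPoly κ) :
    MvPolynomial.pderiv (k, j + 1) (totalDeriv κ f) =
      totalDeriv κ (MvPolynomial.pderiv (k, j + 1) f) + MvPolynomial.pderiv (k, j) f := by
  classical
  have h : ⁅MvPolynomial.pderiv (R := ℝ) (k, j + 1), totalDeriv κ⁆ =
      MvPolynomial.pderiv (k, j) := by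
    refine MvPolynomial.derivation_ext fun p => ?_
    rw [Derivation.commutator_apply, totalDeriv_X, MvPolynomial.pderiv_X, MvPolynomial.pderiv_X,
      MvPolynomial.pderiv_X]
    obtain ⟨k', j'⟩ := p
    by_cases h1 : k' = k <;> by_cases h2 : j' = j <;> by_cases h3 : j' = j + 1 <;>
      simp [h1, h2, h3]
  have := DFunLike.congr_fun h f
  rw [Derivation.commutator_apply] at this
  rw [← this]
  ring

theorem pderiv_totalDeriv_zero (k : κ) (f : JetPoly κ) :
    MvPolynomial.pderiv (k, 0) (totalDeriv κ f) =
      totalDeriv κ (MvPolynomial.pderiv (k, 0) f) := by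
  classical
  have h : ⁅MvPolynomial.pderiv (R := ℝ) (k, 0), totalDeriv κ⁆ = 0 := by
    refine MvPolynomial.derivation_ext fun p => ?_
    rw [Derivation.commutator_apply, totalDeriv_X, MvPolynomial.pderiv_X, MvPolynomial.pderiv_X]
    obtain ⟨k', j'⟩ := p
    by_cases h1 : k' = k <;> by_cases h2 : j' = 0 <;>
      simp [h1, h2]
  have := DFunLike.congr_fun h f
  rw [Derivation.commutator_apply] at this
  exact sub_eq_zero.1 this

theorem pderiv_covDeriv (p : κ × ℕ) (w : ι → JetPoly κ) (i : ι) :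
    MvPolynomial.pderiv p (covDeriv a₀ a w i) =
      MvPolynomial.pderiv p (totalDeriv κ (w i)) +
        ((driftMatrix a₀ a).map (MvPolynomial.pderiv p) *ᵥ w) i +
        (driftMatrix a₀ a *ᵥ fun i => MvPolynomial.pderiv p (w i)) i := by
  have h : ∀ j, MvPolynomial.pderiv p (driftMatrix a₀ a i j * w j) =
      MvPolynomial.pderiv p (driftMatrix a₀ a i j) * w j +
        driftMatrix a₀ a i j * MvPolynomial.pderiv p (w j) := by
    intro j
    rw [Derivation.leibniz, smul_eq_mul, smul_eq_mul]
    ring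
  rw [covDeriv, Pi.add_apply, map_add, add_assoc]
  congr 1
  change MvPolynomial.pderiv p (∑ j, driftMatrix a₀ a i j * w j) = (∑ j, _) + (∑ j, _)
  rw [map_sum, ← Finset.sum_add_distrib]
  exact Finset.sum_congr rfl fun j _ => h j

theorem pderiv_driftMatrix_zero (k : κ) :
    (driftMatrix a₀ a).map (MvPolynomial.pderiv (k, 0)) = (a k).map MvPolynomial.C := by
  classical
  ext1 i j
  simp only [driftMatrix, Matrix.map_apply, Matrix.add_apply, Matrix.sum_apply, Matrix.smul_apply,
    smul_eq_mul, map_add, map_sum, Derivation.leibniz, MvPolynomial.pderiv_C,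
    MvPolynomial.pderiv_X]
  rw [Finset.sum_eq_single k]
  · simp
  · intro b _ hb
    simp [hb]
  · simp

/-- Descending induction on the jet order, from the range where stability is known. The drift matrix
contains only the variables of order `0`, so the commutator of `∂/∂uₖ⁽ʲ⁺¹⁾` with `covDeriv` is
exactly `∂/∂uₖ⁽ʲ⁾`. -/
theorem pderiv_mem_iterModule (p : κ × ℕ) {w : ι → JetPoly κ} (hw : w ∈ iterModule a₀ a s) :
    (fun i => MvPolynomial.pderiv p (w i)) ∈ iterModule a₀ a s := by
  obtain ⟨N, hN⟩ := exists_pderiv_mem_iterModule a₀ a s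
  have key : ∀ d j : ℕ, N ≤ j + d → ∀ k : κ, ∀ w ∈ iterModule a₀ a s,
      (fun i => MvPolynomial.pderiv (k, j) (w i)) ∈ iterModule a₀ a s := by
    intro d
    induction d with
    | zero => exact fun j hj k w hw => hN (k, j) hj w hw
    | succ d ih =>
      intro j hj k w hw
      have h1 := ih (j + 1) (by omega) k _ (covDeriv_mem_iterModule a₀ a s hw)
      have h2 := covDeriv_mem_iterModule a₀ a s (ih (j + 1) (by omega) k w hw)
      have h3 := sub_mem h1 h2
      convert h3 using 1
      ext1 i
      have hz : (driftMatrix a₀ a).map (MvPolynomial.pderiv (k, j + 1)) = 0 := by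
        ext1 i i'
        exact pderiv_eq_zero_of_mem (driftMatrix_mem a₀ a i i') (by simp)
      rw [Pi.sub_apply, pderiv_covDeriv, hz, pderiv_totalDeriv_succ]
      simp [covDeriv]
  exact key N p.2 (by omega) p.1 w hw

/-- At order `0` the partial derivative commutes with the total derivative but sees the drift
matrix, so its commutator with `covDeriv` is multiplication by `a k`. -/
theorem mulVec_mem_iterModule (k : κ) {w : ι → JetPoly κ} (hw : w ∈ iterModule a₀ a s) :
    (a k).map MvPolynomial.C *ᵥ w ∈ iterModule a₀ a s := by
  have h1 := pderiv_mem_iterModule a₀ a s (k, 0) (covDeriv_mem_iterModule a₀ a s hw)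
  have h2 := covDeriv_mem_iterModule a₀ a s (pderiv_mem_iterModule a₀ a s (k, 0) hw)
  convert sub_mem h1 h2 using 1
  ext1 i
  rw [Pi.sub_apply, pderiv_covDeriv, pderiv_driftMatrix_zero, pderiv_totalDeriv_zero]
  simp [covDeriv]

/-- For a constant vector the total derivative vanishes, so `covDeriv` is `a₀` plus the control
terms, and these are already in the module. Constancy matters: stability under the total derivative
alone is not available. -/
theorem mulVec_drift_mem_iterModule {x : ι → ℝ}
    (hw : (fun i => MvPolynomial.C (x i)) ∈ iterModule a₀ a s) :
    a₀.map MvPolynomial.C *ᵥ (fun i => MvPolynomial.C (x i)) ∈ iterModule a₀ a s := by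
  have h1 := covDeriv_mem_iterModule a₀ a s hw
  have h2 : ∑ k, (MvPolynomial.X (k, 0) : JetPoly κ) •
      ((a k).map MvPolynomial.C *ᵥ fun i => (MvPolynomial.C (x i) : JetPoly κ)) ∈
        iterModule a₀ a s :=
    sum_mem fun k _ => Submodule.smul_mem _ _ (mulVec_mem_iterModule a₀ a s k hw)
  convert sub_mem h1 h2 using 1
  have h0 : (fun i => totalDeriv κ (MvPolynomial.C (x i))) = 0 := by
    ext1 i
    exact (totalDeriv κ).map_algebraMap (x i)
  rw [covDeriv, h0, driftMatrix, Matrix.add_mulVec, Matrix.sum_mulVec]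
  simp [Matrix.smul_mulVec]

/-- The real vectors of the saturated module of the iterated vectors. -/
def realIterModule : Submodule ℝ (ι → ℝ) where
  carrier := {x | (fun i => MvPolynomial.C (x i)) ∈ iterModule a₀ a s}
  zero_mem' := by
    simp only [mem_ofPred_eq, Pi.zero_apply, map_zero]
    exact zero_mem (iterModule a₀ a s)
  add_mem' := by
    intro x y hx hy
    simp only [mem_ofPred_eq, Pi.add_apply, map_add] at *
    exact add_mem hx hy
  smul_mem' := by
    intro c x hx
    simp only [mem_ofPred_eq, Pi.smul_apply, smul_eq_mul, map_mul] at *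
    exact Submodule.smul_mem _ (MvPolynomial.C c) hx

theorem vec_mem_realIterModule (k : κ) : s k ∈ realIterModule a₀ a s :=
  iterVec_mem_iterModule a₀ a s k 0

theorem map_C_mulVec (b : Matrix ι ι ℝ) (x : ι → ℝ) :
    b.map MvPolynomial.C *ᵥ (fun i => (MvPolynomial.C (x i) : JetPoly κ)) =
      fun i => MvPolynomial.C ((b *ᵥ x) i) := by
  ext1 i
  simp [Matrix.mulVec, dotProduct]

theorem drift_mulVec_mem_realIterModule {x : ι → ℝ} (hx : x ∈ realIterModule a₀ a s) :
    a₀ *ᵥ x ∈ realIterModule a₀ a s := by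
  have h := mulVec_drift_mem_iterModule a₀ a s hx
  rwa [map_C_mulVec] at h

theorem control_mulVec_mem_realIterModule (k : κ) {x : ι → ℝ} (hx : x ∈ realIterModule a₀ a s) :
    a k *ᵥ x ∈ realIterModule a₀ a s := by
  have h := mulVec_mem_iterModule a₀ a s k hx
  rwa [map_C_mulVec] at h

/-- The evaluation of a vector of jet polynomials at a jet. -/
def evalVec (v : κ × ℕ → ℝ) (w : ι → JetPoly κ) : ι → ℝ := fun i => MvPolynomial.eval v (w i)

theorem evalVec_mem_span {G : Set (ι → JetPoly κ)} {w : ι → JetPoly κ}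
    (hw : w ∈ Submodule.span (JetPoly κ) G) (v : κ × ℕ → ℝ) :
    evalVec v w ∈ Submodule.span ℝ (evalVec v '' G) := by
  induction hw using Submodule.span_induction with
  | mem x hx => exact Submodule.subset_span ⟨x, hx, rfl⟩
  | zero =>
    convert zero_mem (Submodule.span ℝ (evalVec v '' G))
    ext1 i
    simp [evalVec]
  | add x y _ _ hx hy =>
    convert add_mem hx hy
    ext1 i
    simp [evalVec]
  | smul c x _ hx =>
    convert Submodule.smul_mem _ (MvPolynomial.eval v c) hx
    ext1 i
    simp [evalVec]

/-- At a generic jet, the iterated vectors of bounded order span `realIterModule`. -/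
theorem exists_generic_polynomial :
    ∃ (N : ℕ) (Q : JetPoly κ), Q ≠ 0 ∧ ∀ v : κ × ℕ → ℝ, MvPolynomial.eval v Q ≠ 0 →
      realIterModule a₀ a s ≤
        Submodule.span ℝ {x | ∃ k, ∃ j < N, x = evalVec v (iterVec a₀ a s k j)} := by
  classical
  have hb := Module.finBasis ℝ (realIterModule a₀ a s)
  set r := Module.finrank ℝ (realIterModule a₀ a s)
  -- Each basis vector lies in the span only after multiplication by some `q i`; the product of
  -- these denominators is the polynomial sought.
  choose q hq hmem using fun i : Fin r => mem_saturation.1 (hb i).2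
  have hfin : ∀ i, ∃ T : Finset (ι → JetPoly κ),
      (T : Set (ι → JetPoly κ)) ⊆ Set.range (fun p : κ × ℕ => iterVec a₀ a s p.1 p.2) ∧
        q i • (fun j => (MvPolynomial.C ((hb i : ι → ℝ) j) : JetPoly κ)) ∈
          Submodule.span (JetPoly κ) (T : Set (ι → JetPoly κ)) :=
    fun i => Submodule.mem_span_finite_of_mem_span (hmem i)
  choose T hT hTmem using hfin
  -- An order is attached to every vector, with `0` as a dummy value off the family, so that a
  -- supremum over a finite set of generators makes sense.
  have hord : ∀ g : ι → JetPoly κ, ∃ j : ℕ, g ∈ Set.range (fun p : κ × ℕ =>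
      iterVec a₀ a s p.1 p.2) → ∃ k, g = iterVec a₀ a s k j := by
    intro g
    by_cases hg : g ∈ Set.range (fun p : κ × ℕ => iterVec a₀ a s p.1 p.2)
    · obtain ⟨p, rfl⟩ := hg
      exact ⟨p.2, fun _ => ⟨p.1, rfl⟩⟩
    · exact ⟨0, fun h => absurd h hg⟩
  choose ord hord using hord
  refine ⟨(Finset.univ.biUnion T).sup ord + 1, ∏ i, q i, Finset.prod_ne_zero_iff.2 fun i _ => hq i,
    fun v hv => ?_⟩
  rw [map_prod, Finset.prod_ne_zero_iff] at hv
  have hbasis : ∀ i, (hb i : ι → ℝ) ∈ Submodule.span ℝ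
      {x | ∃ k, ∃ j < (Finset.univ.biUnion T).sup ord + 1,
        x = evalVec v (iterVec a₀ a s k j)} := by
    intro i
    have h1 := evalVec_mem_span (hTmem i) v
    have h2 : evalVec v (q i • (fun j => (MvPolynomial.C ((hb i : ι → ℝ) j) : JetPoly κ))) =
        MvPolynomial.eval v (q i) • (hb i : ι → ℝ) := by
      ext1 j
      simp [evalVec]
    rw [h2] at h1
    have h3 := (Submodule.smul_mem_iff _ (hv i (Finset.mem_univ i))).1 h1
    refine Submodule.span_mono ?_ h3
    rintro _ ⟨g, hg, rfl⟩
    obtain ⟨k, hk⟩ := hord g (hT i hg)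
    refine ⟨k, ord g, Nat.lt_succ_of_le (Finset.le_sup (Finset.mem_biUnion.2
      ⟨i, Finset.mem_univ i, hg⟩)), by rw [← hk]⟩
  intro x hx
  have hx' := hb.sum_repr ⟨x, hx⟩
  have hx2 := congrArg Subtype.val hx'
  simp only [Submodule.coe_sum, Submodule.coe_smul] at hx2
  rw [← hx2]
  exact sum_mem fun i _ => Submodule.smul_mem _ _ (hbasis i)

end Generic

/-! ### Linear differential equations with an invariant subspace -/

/-- A solution of a linear differential equation that starts in an invariant subspace stays there. -/
theorem mem_of_linear_ode {E : Type*} [NormedAddCommGroup E] [NormedSpace ℝ E]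
    [FiniteDimensional ℝ E] {κ : Type*} [Fintype κ] (J : Submodule ℝ E) (L₀ : E →ₗ[ℝ] E)
    (L : κ → E →ₗ[ℝ] E) (h₀ : ∀ y ∈ J, L₀ y ∈ J) (hL : ∀ k, ∀ y ∈ J, L k y ∈ J) {T B : ℝ}
    {u : κ → ℝ → ℝ} (hu : ∀ k, ∀ t ∈ Icc 0 T, |u k t| ≤ B) {Y : ℝ → E}
    (hY : ContinuousOn Y (Icc 0 T))
    (hY' : ∀ t ∈ Ico 0 T, HasDerivWithinAt Y (L₀ (Y t) + ∑ k, u k t • L k (Y t)) (Ici t) t)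
    (hY0 : Y 0 ∈ J) : ∀ t ∈ Icc 0 T, Y t ∈ J := by
  obtain ⟨p, hp⟩ := LinearMap.exists_leftInverse_of_injective J.subtype
    (LinearMap.ker_eq_bot.2 J.injective_subtype)
  have hpJ : ∀ y (hy : y ∈ J), ((p y : J) : E) = y := fun y hy =>
    congrArg Subtype.val (LinearMap.congr_fun hp ⟨y, hy⟩)
  -- The projection `q` along `J` has kernel `J`, and `q F = q F q` for every `F` preserving `J`. So
  -- `q (Y t)` solves a linear equation with bounded coefficients and zero initial value, and
  -- Gronwall applies.
  let q : E →ₗ[ℝ] E := LinearMap.id - J.subtype ∘ₗ p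
  have hq : ∀ y, q y = y - (p y : E) := fun y => rfl
  have hq0 : ∀ y ∈ J, q y = 0 := fun y hy => by rw [hq, hpJ y hy, sub_self]
  have hqJ : ∀ y, q y = 0 → y ∈ J := fun y hy => by
    rw [hq, sub_eq_zero] at hy
    rw [hy]
    exact (p y).2
  have hqL : ∀ F : E →ₗ[ℝ] E, (∀ y ∈ J, F y ∈ J) → ∀ y, q (F y) = q (F (q y)) := by
    intro F hF y
    have : F y = F (q y) + F (p y : E) := by rw [← map_add, hq, sub_add_cancel]
    rw [this, map_add, hq0 _ (hF _ (p y).2), add_zero]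
  let q' : E →L[ℝ] E := LinearMap.toContinuousLinearMap q
  let c₀ : E →L[ℝ] E := LinearMap.toContinuousLinearMap (q ∘ₗ L₀)
  let c : κ → E →L[ℝ] E := fun k => LinearMap.toContinuousLinearMap (q ∘ₗ L k)
  intro t ht
  apply hqJ
  refine eq_zero_of_abs_deriv_le_mul_abs_self_of_eq_zero_right (f := fun t => q' (Y t))
    (f' := fun t => q' (L₀ (Y t) + ∑ k, u k t • L k (Y t)))
    (K := ‖c₀‖ + ∑ k, B * ‖c k‖) (q'.continuous.comp_continuousOn hY)
    (fun x hx => q'.hasFDerivAt.comp_hasDerivWithinAt x (hY' x hx)) (hq0 _ hY0) ?_ t ht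
  intro x hx
  have hexp : q' (L₀ (Y x) + ∑ k, u k x • L k (Y x)) =
      c₀ (q (Y x)) + ∑ k, u k x • c k (q (Y x)) := by
    change q (L₀ (Y x) + ∑ k, u k x • L k (Y x)) =
      q (L₀ (q (Y x))) + ∑ k, u k x • q (L k (q (Y x)))
    rw [map_add, map_sum, hqL L₀ h₀]
    congr 1
    refine Finset.sum_congr rfl fun k _ => ?_
    rw [map_smul, hqL (L k) (hL k)]
  rw [hexp]
  refine (norm_add_le _ _).trans ?_
  rw [add_mul, Finset.sum_mul]
  refine add_le_add (c₀.le_opNorm _) ((norm_sum_le _ _).trans (Finset.sum_le_sum fun k _ => ?_))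
  rw [norm_smul, mul_assoc]
  exact mul_le_mul (hu k x ⟨hx.1, hx.2.le⟩) ((c k).le_opNorm _) (norm_nonneg _)
    ((abs_nonneg _).trans (hu k x ⟨hx.1, hx.2.le⟩))

/-! ### Matrix-valued curves and the consequences of controllability. -/

section Matrices

variable {n m : ℕ}

theorem hasDerivWithinAt_matrix_mul {X Y : ℝ → Matrix (Fin n) (Fin n) ℂ}
    {A B : Matrix (Fin n) (Fin n) ℂ} {s : Set ℝ} {t : ℝ} (hX : HasDerivWithinAt X A s t)
    (hY : HasDerivWithinAt Y B s t) :
    HasDerivWithinAt (fun s => X s * Y s) (A * Y t + X t * B) s t := by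
  let _ : NormedRing (Matrix (Fin n) (Fin n) ℂ) := Matrix.linftyOpNormedRing
  let _ : NormedAlgebra ℝ (Matrix (Fin n) (Fin n) ℂ) := Matrix.linftyOpNormedAlgebra
  exact HasDerivWithinAt.mul hX hY

theorem hasDerivWithinAt_matrix_const (y : Matrix (Fin n) (Fin n) ℂ) (s : Set ℝ) (t : ℝ) :
    HasDerivWithinAt (fun _ : ℝ => y) 0 s t := by
  let _ : NormedAddCommGroup (Matrix (Fin n) (Fin n) ℂ) := Matrix.normedAddCommGroup
  let _ : NormedSpace ℝ (Matrix (Fin n) (Fin n) ℂ) := Matrix.normedSpace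
  exact hasDerivWithinAt_const t s y

theorem hasDerivWithinAt_linearMap {F : Type*} [NormedAddCommGroup F] [NormedSpace ℝ F]
    (φ : Matrix (Fin n) (Fin n) ℂ →ₗ[ℝ] F) {X : ℝ → Matrix (Fin n) (Fin n) ℂ}
    {A : Matrix (Fin n) (Fin n) ℂ} {s : Set ℝ} {t : ℝ} (hX : HasDerivWithinAt X A s t) :
    HasDerivWithinAt (fun s => φ (X s)) (φ A) s t := by
  let _ : NormedAddCommGroup (Matrix (Fin n) (Fin n) ℂ) := Matrix.normedAddCommGroup
  let _ : NormedSpace ℝ (Matrix (Fin n) (Fin n) ℂ) := Matrix.normedSpace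
  exact (LinearMap.toContinuousLinearMap φ).hasFDerivAt.comp_hasDerivWithinAt t hX

theorem hasDerivWithinAt_conjTranspose {X : ℝ → Matrix (Fin n) (Fin n) ℂ}
    {A : Matrix (Fin n) (Fin n) ℂ} {s : Set ℝ} {t : ℝ} (hX : HasDerivWithinAt X A s t) :
    HasDerivWithinAt (fun s => (X s)ᴴ) Aᴴ s t := by
  let _ : NormedAddCommGroup (Matrix (Fin n) (Fin n) ℂ) := Matrix.normedAddCommGroup
  let _ : NormedSpace ℝ (Matrix (Fin n) (Fin n) ℂ) := Matrix.normedSpace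
  exact HasDerivWithinAt.star hX

theorem mem_of_matrix_ode {κ : Type*} [Fintype κ] (J : Submodule ℝ (Matrix (Fin n) (Fin n) ℂ))
    (L₀ : Matrix (Fin n) (Fin n) ℂ →ₗ[ℝ] Matrix (Fin n) (Fin n) ℂ)
    (L : κ → Matrix (Fin n) (Fin n) ℂ →ₗ[ℝ] Matrix (Fin n) (Fin n) ℂ)
    (h₀ : ∀ y ∈ J, L₀ y ∈ J) (hL : ∀ k, ∀ y ∈ J, L k y ∈ J) {T B : ℝ}
    {u : κ → ℝ → ℝ} (hu : ∀ k, ∀ t ∈ Icc 0 T, |u k t| ≤ B) {Y : ℝ → Matrix (Fin n) (Fin n) ℂ}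
    (hY : ContinuousOn Y (Icc 0 T))
    (hY' : ∀ t ∈ Ico 0 T, HasDerivWithinAt Y (L₀ (Y t) + ∑ k, u k t • L k (Y t)) (Ici t) t)
    (hY0 : Y 0 ∈ J) : ∀ t ∈ Icc 0 T, Y t ∈ J := by
  let _ : NormedAddCommGroup (Matrix (Fin n) (Fin n) ℂ) := Matrix.normedAddCommGroup
  let _ : NormedSpace ℝ (Matrix (Fin n) (Fin n) ℂ) := Matrix.normedSpace
  exact mem_of_linear_ode J L₀ L h₀ hL hu hY hY' hY0

theorem skew_conjTranspose {H : Matrix (Fin n) (Fin n) ℂ} (hH : H.IsHermitian) :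
    (skew H)ᴴ = -skew H := by
  simp [skew, Matrix.conjTranspose_smul, hH.eq]

theorem generator_conjTranspose {H₀ : Matrix (Fin n) (Fin n) ℂ}
    {H : Fin m → Matrix (Fin n) (Fin n) ℂ} (hH₀ : H₀.IsHermitian) (hH : ∀ k, (H k).IsHermitian)
    (v : Fin m → ℝ) : (generator H₀ H v)ᴴ = -generator H₀ H v := by
  simp only [generator, Matrix.conjTranspose_add, Matrix.conjTranspose_sum,
    Matrix.conjTranspose_smul, skew_conjTranspose hH₀, skew_conjTranspose (hH _), star_trivial,
    smul_neg, Finset.sum_neg_distrib, neg_add]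

/-- The linear map `y ↦ [y, S]`. -/
def bracketRight (S : Matrix (Fin n) (Fin n) ℂ) :
    Matrix (Fin n) (Fin n) ℂ →ₗ[ℝ] Matrix (Fin n) (Fin n) ℂ :=
  LinearMap.mulRight ℝ S - LinearMap.mulLeft ℝ S

@[simp]
theorem bracketRight_apply (S y : Matrix (Fin n) (Fin n) ℂ) :
    bracketRight S y = y * S - S * y := rfl

theorem unitary_conjTranspose_mul (U : Matrix.unitaryGroup (Fin n) ℂ) :
    (U : Matrix (Fin n) (Fin n) ℂ)ᴴ * U = 1 := Matrix.mem_unitaryGroup_iff'.1 U.2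

theorem unitary_mul_conjTranspose (U : Matrix.unitaryGroup (Fin n) ℂ) :
    (U : Matrix (Fin n) (Fin n) ℂ) * (U : Matrix (Fin n) (Fin n) ℂ)ᴴ = 1 :=
  Matrix.mem_unitaryGroup_iff.1 U.2

/-- For a controllable system, a subspace that is invariant under the left multiplications by the
`S_k` and contains the identity contains all unitary matrices. -/
theorem unitary_mem_of_controllable {H₀ : Matrix (Fin n) (Fin n) ℂ}
    {H : Fin m → Matrix (Fin n) (Fin n) ℂ} (hctrl : Controllable H₀ H)
    (J : Submodule ℝ (Matrix (Fin n) (Fin n) ℂ)) (h1 : 1 ∈ J) (h₀ : ∀ y ∈ J, skew H₀ * y ∈ J)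
    (hk : ∀ k, ∀ y ∈ J, skew (H k) * y ∈ J) (U : Matrix.unitaryGroup (Fin n) ℂ) :
    (U : Matrix (Fin n) (Fin n) ℂ) ∈ J := by
  obtain ⟨T, u, X, hT, ⟨B, hB⟩, -, hX, hX', hX0, hXT⟩ := hctrl U
  have := mem_of_matrix_ode J (LinearMap.mulLeft ℝ (skew H₀))
    (fun k => LinearMap.mulLeft ℝ (skew (H k))) h₀ hk hB
    (Y := fun t => (X t : Matrix (Fin n) (Fin n) ℂ))
    (continuous_subtype_val.comp_continuousOn hX) ?_ ?_ T ⟨hT, le_rfl⟩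
  · simpa [hXT] using this
  · intro t ht
    convert hX' t ht using 1
    simp only [generator, LinearMap.mulLeft_apply, add_mul, Finset.sum_mul, Matrix.smul_mul]
  · simpa [hX0] using h1

/-- For a controllable system, a subspace that is invariant under the brackets with the `S_k` is
invariant under unitary conjugations. -/
theorem conj_mem_of_controllable {H₀ : Matrix (Fin n) (Fin n) ℂ}
    {H : Fin m → Matrix (Fin n) (Fin n) ℂ} (hH₀ : H₀.IsHermitian) (hH : ∀ k, (H k).IsHermitian)
    (hctrl : Controllable H₀ H) (J : Submodule ℝ (Matrix (Fin n) (Fin n) ℂ))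
    (h₀ : ∀ y ∈ J, bracketRight (skew H₀) y ∈ J)
    (hk : ∀ k, ∀ y ∈ J, bracketRight (skew (H k)) y ∈ J) (U : Matrix.unitaryGroup (Fin n) ℂ)
    {y : Matrix (Fin n) (Fin n) ℂ} (hy : y ∈ J) :
    (U : Matrix (Fin n) (Fin n) ℂ) * y * (U : Matrix (Fin n) (Fin n) ℂ)ᴴ ∈ J := by
  obtain ⟨T, u, X, hT, ⟨B, hB⟩, -, hX, hX', hX0, hXT⟩ := hctrl U
  have hXc : ContinuousOn (fun t => (X t : Matrix (Fin n) (Fin n) ℂ)) (Icc 0 T) :=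
    continuous_subtype_val.comp_continuousOn hX
  -- The generator `G` is skew-Hermitian, so `Y = X y X†` solves `Y' = G Y - Y G`, a linear equation
  -- that preserves `J`.
  have := mem_of_matrix_ode J (-bracketRight (skew H₀)) (fun k => -bracketRight (skew (H k)))
    (fun y hy => neg_mem (h₀ y hy)) (fun k y hy => neg_mem (hk k y hy)) hB
    (Y := fun t => (X t : Matrix (Fin n) (Fin n) ℂ) * y * (X t : Matrix (Fin n) (Fin n) ℂ)ᴴ)
    ?_ ?_ ?_ T ⟨hT, le_rfl⟩
  · simpa [hXT] using this
  · exact (hXc.mul continuousOn_const).mul (continuous_id.matrix_conjTranspose.comp_continuousOn hXc)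
  · intro t ht
    have hd := hasDerivWithinAt_matrix_mul (hasDerivWithinAt_matrix_mul (hX' t ht)
      (hasDerivWithinAt_matrix_const y (Ici t) t)) (hasDerivWithinAt_conjTranspose (hX' t ht))
    convert hd using 1
    rw [mul_zero, add_zero, Matrix.conjTranspose_mul, generator_conjTranspose hH₀ hH]
    simp only [LinearMap.neg_apply, bracketRight_apply, generator, mul_add, add_mul, neg_sub,
      Finset.mul_sum, Finset.sum_mul, mul_neg, smul_sub, Finset.sum_sub_distrib, Matrix.mul_smul,
      Matrix.smul_mul, Matrix.mul_assoc, neg_add]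
    abel
  · simpa [hX0] using hy

/-! ### Subspaces of matrices that are invariant under unitary conjugation -/

theorem exists_skew_diagonalization {z : Matrix (Fin n) (Fin n) ℂ} (hz : zᴴ = -z) :
    ∃ (U : Matrix.unitaryGroup (Fin n) ℂ) (f : Fin n → ℝ),
      z = (U : Matrix (Fin n) (Fin n) ℂ) * diagonal (fun i => Complex.I * (f i : ℂ)) *
        (U : Matrix (Fin n) (Fin n) ℂ)ᴴ := by
  have hA : (Complex.I • z).IsHermitian := by
    simp [Matrix.IsHermitian, Matrix.conjTranspose_smul, hz]
  refine ⟨hA.eigenvectorUnitary, fun i => -hA.eigenvalues i, ?_⟩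
  have h := hA.spectral_theorem
  rw [Unitary.conjStarAlgAut_apply] at h
  have h2 : z = (-Complex.I) • (Complex.I • z) := by
    rw [smul_smul]
    simp
  refine h2.trans ((congrArg (fun w => (-Complex.I) • w) h).trans ?_)
  rw [← Matrix.smul_mul, ← Matrix.mul_smul]
  congr 2
  rw [← Matrix.diagonal_smul]
  congr 1
  ext1 i
  simp

/-- The permutation matrices as unitary matrices. -/
def permUnitary (σ : Equiv.Perm (Fin n)) : Matrix.unitaryGroup (Fin n) ℂ :=
  ⟨σ.permMatrix ℂ, by
    rw [Matrix.mem_unitaryGroup_iff, Matrix.star_eq_conjTranspose,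
      Matrix.conjTranspose_permMatrix, ← Matrix.permMatrix_mul]
    simp⟩

theorem permUnitary_mul_diagonal (σ : Equiv.Perm (Fin n)) (f : Fin n → ℂ) :
    (permUnitary σ : Matrix (Fin n) (Fin n) ℂ) * diagonal f =
      diagonal (f ∘ σ) * (permUnitary σ : Matrix (Fin n) (Fin n) ℂ) := by
  ext i j
  rw [Matrix.mul_diagonal, Matrix.diagonal_mul, Function.comp_apply]
  simp only [permUnitary, Equiv.Perm.permMatrix, PEquiv.toMatrix_apply, Equiv.toPEquiv_apply,
    Option.mem_some_iff]
  split_ifs with h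
  · rw [h]; ring
  · simp

theorem exists_perm_map_pair {p q p' q' : Fin n} (h : p ≠ q) (h' : p' ≠ q') :
    ∃ σ : Equiv.Perm (Fin n), σ p' = p ∧ σ q' = q := by
  refine ⟨Equiv.swap (Equiv.swap p' p q') q * Equiv.swap p' p, ?_, ?_⟩
  · rw [Equiv.Perm.mul_apply, Equiv.swap_apply_left]
    refine Equiv.swap_apply_of_ne_of_ne (fun hp => h' ?_) h
    exact (Equiv.swap p' p).injective ((Equiv.swap_apply_left p' p).trans hp)
  · rw [Equiv.Perm.mul_apply, Equiv.swap_apply_left]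

/-- A subspace that is invariant under unitary conjugation and contains a skew-Hermitian matrix
that is not scalar contains all traceless skew-Hermitian matrices. -/
theorem traceless_skew_mem (J : Submodule ℝ (Matrix (Fin n) (Fin n) ℂ))
    (hJ : ∀ (U : Matrix.unitaryGroup (Fin n) ℂ), ∀ y ∈ J,
      (U : Matrix (Fin n) (Fin n) ℂ) * y * (U : Matrix (Fin n) (Fin n) ℂ)ᴴ ∈ J)
    {y : Matrix (Fin n) (Fin n) ℂ} (hyJ : y ∈ J) (hy : yᴴ = -y) (hns : ∀ c : ℂ, y ≠ c • 1)
    {z : Matrix (Fin n) (Fin n) ℂ} (hz : zᴴ = -z) (htr : z.trace = 0) : z ∈ J := by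
  let D : (Fin n → ℝ) →ₗ[ℝ] Matrix (Fin n) (Fin n) ℂ :=
    { toFun := fun f => diagonal fun i => Complex.I * (f i : ℂ)
      map_add' := by
        intro f g
        rw [Matrix.diagonal_add]
        congr 1
        ext1 i
        simp [mul_add]
      map_smul' := by
        intro c f
        rw [RingHom.id_apply, ← Matrix.diagonal_smul]
        congr 1
        ext1 i
        simp only [Pi.smul_apply, smul_eq_mul, Complex.ofReal_mul, Complex.real_smul]
        ring }
  have hD : ∀ f, D f = diagonal fun i => Complex.I * (f i : ℂ) := fun f => rfl
  have hback : ∀ (U : Matrix.unitaryGroup (Fin n) ℂ) (w : Matrix (Fin n) (Fin n) ℂ),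
      (U : Matrix (Fin n) (Fin n) ℂ) * w * (U : Matrix (Fin n) (Fin n) ℂ)ᴴ ∈ J → w ∈ J := by
    intro U w hw
    have h := hJ U⁻¹ _ hw
    have hU : ((U⁻¹ : Matrix.unitaryGroup (Fin n) ℂ) : Matrix (Fin n) (Fin n) ℂ) =
        (U : Matrix (Fin n) (Fin n) ℂ)ᴴ := rfl
    rw [hU, Matrix.conjTranspose_conjTranspose] at h
    simpa [Matrix.mul_assoc, ← Matrix.mul_assoc _ _ w, unitary_conjTranspose_mul] using h
  have hperm : ∀ (σ : Equiv.Perm (Fin n)) f, D f ∈ J → D (f ∘ σ) ∈ J := by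
    intro σ f hf
    have h := hJ (permUnitary σ) _ hf
    rwa [hD, permUnitary_mul_diagonal, Matrix.mul_assoc, unitary_mul_conjTranspose,
      Matrix.mul_one] at h
  obtain ⟨U, f, rfl⟩ := exists_skew_diagonalization hy
  have hf : D f ∈ J := hback U _ hyJ
  obtain ⟨p, q, hpq⟩ : ∃ p q, f p ≠ f q := by
    by_contra! hcon
    rcases isEmpty_or_nonempty (Fin n) with hn | ⟨⟨i₀⟩⟩
    · exact hns 0 (Matrix.ext fun i => hn.elim i)
    · refine hns (Complex.I * (f i₀ : ℂ)) ?_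
      have : (fun i => Complex.I * (f i : ℂ)) = fun _ => Complex.I * (f i₀ : ℂ) := by
        ext1 i
        rw [hcon i i₀]
      rw [this, ← Matrix.smul_one_eq_diagonal, Matrix.mul_smul, Matrix.smul_mul, Matrix.mul_one,
        unitary_mul_conjTranspose]
  have hne : p ≠ q := fun h => hpq (by rw [h])
  -- Two diagonal entries of `f` differ. Subtracting from `f` its image under their transposition
  -- leaves a nonzero multiple of the difference of two coordinate vectors; permutations then yield
  -- enough such differences to span all diagonals of sum zero.
  have hroot : D (Pi.single p 1 - Pi.single q 1) ∈ J := by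
    have h1 : D (f - f ∘ Equiv.swap p q) ∈ J := by
      rw [map_sub]
      exact sub_mem hf (hperm _ _ hf)
    have h2 : f - f ∘ Equiv.swap p q = (f p - f q) • (Pi.single p 1 - Pi.single q 1) := by
      ext1 i
      by_cases hip : i = p
      · subst hip
        simp [hne]
      · by_cases hiq : i = q
        · subst hiq
          simp [hip]
        · simp [hip, hiq, Equiv.swap_apply_of_ne_of_ne]
    rw [h2, map_smul] at h1
    exact (Submodule.smul_mem_iff _ (sub_ne_zero.2 hpq)).1 h1
  have hroots : ∀ i, D (Pi.single i 1 - Pi.single p 1) ∈ J := by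
    intro i
    by_cases hi : i = p
    · rw [hi, sub_self, map_zero]
      exact zero_mem _
    · obtain ⟨σ, h1, h2⟩ := exists_perm_map_pair hne hi
      convert hperm σ _ hroot using 2
      ext1 j
      have e1 : (σ j = p) = (j = i) := by rw [← h1, σ.injective.eq_iff]
      have e2 : (σ j = q) = (j = p) := by rw [← h2, σ.injective.eq_iff]
      simp [Pi.single_apply, e1, e2]
  obtain ⟨V, g, rfl⟩ := exists_skew_diagonalization hz
  refine hJ V _ ?_
  have hg : ∑ i, g i = 0 := by
    rw [Matrix.trace_mul_comm, ← Matrix.mul_assoc, unitary_conjTranspose_mul, Matrix.one_mul,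
      Matrix.trace_diagonal, ← Finset.mul_sum, mul_eq_zero] at htr
    have := htr.resolve_left Complex.I_ne_zero
    exact_mod_cast this
  have hgs : g = ∑ i, g i • (Pi.single i 1 - Pi.single p 1 : Fin n → ℝ) := by
    simp only [smul_sub, Finset.sum_sub_distrib, ← Finset.sum_smul, hg, zero_smul, sub_zero]
    ext1 j
    simp [Finset.sum_apply, Pi.single_apply]
  rw [← hD, hgs, map_sum]
  exact sum_mem fun i _ => by
    rw [map_smul]
    exact Submodule.smul_mem _ _ (hroots i)

/-- A transposition matrix does not commute with the diagonal reflection that changes the sign of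
one of the two exchanged coordinates. -/
theorem exists_unitary_not_commute (hn : 2 ≤ n) : ∃ U V : Matrix.unitaryGroup (Fin n) ℂ,
    (U : Matrix (Fin n) (Fin n) ℂ) * V ≠ V * U := by
  let i : Fin n := ⟨0, by omega⟩
  let j : Fin n := ⟨1, by omega⟩
  have hij : i ≠ j := by simp [i, j, Fin.ext_iff]
  let f : Fin n → ℂ := fun k => if k = i then -1 else 1
  have hf : diagonal f ∈ Matrix.unitaryGroup (Fin n) ℂ := by
    rw [Matrix.mem_unitaryGroup_iff, Matrix.star_eq_conjTranspose, Matrix.diagonal_conjTranspose,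
      Matrix.diagonal_mul_diagonal, ← Matrix.diagonal_one]
    congr 1
    ext1 k
    by_cases hk : k = i <;> simp [f, hk]
  refine ⟨permUnitary (Equiv.swap i j), ⟨diagonal f, hf⟩, fun h => ?_⟩
  have h' := congrFun (congrFun h i) j
  change ((permUnitary (Equiv.swap i j) : Matrix (Fin n) (Fin n) ℂ) * diagonal f) i j =
    (diagonal f * (permUnitary (Equiv.swap i j) : Matrix (Fin n) (Fin n) ℂ)) i j at h'
  rw [Matrix.mul_diagonal, Matrix.diagonal_mul] at h'
  simp only [permUnitary, Equiv.Perm.permMatrix, PEquiv.toMatrix_apply, Equiv.toPEquiv_apply,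
    Option.mem_some_iff, Equiv.swap_apply_left, f, hij.symm] at h'
  norm_num at h'

/-- For a controllable system, a subspace that contains the `S_k` and is invariant under the
brackets with `S_0` and the `S_k` contains all traceless skew-Hermitian matrices. -/
theorem traceless_skew_mem_of_controllable {H₀ : Matrix (Fin n) (Fin n) ℂ}
    {H : Fin m → Matrix (Fin n) (Fin n) ℂ} (hH₀ : H₀.IsHermitian) (hH : ∀ k, (H k).IsHermitian)
    (hctrl : Controllable H₀ H) (J : Submodule ℝ (Matrix (Fin n) (Fin n) ℂ))
    (hS : ∀ k, skew (H k) ∈ J) (h₀ : ∀ y ∈ J, bracketRight (skew H₀) y ∈ J)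
    (hk : ∀ k, ∀ y ∈ J, bracketRight (skew (H k)) y ∈ J)
    {z : Matrix (Fin n) (Fin n) ℂ} (hz : zᴴ = -z) (htr : z.trace = 0) : z ∈ J := by
  by_cases hscal : ∀ k, ∃ c : ℂ, skew (H k) = c • 1
  · rcases lt_or_ge n 2 with hn | hn
    · have hz0 : z = 0 := by
        ext i j
        have hij : ∀ l : Fin n, l = i := fun l => by
          ext
          have := l.2
          have := i.2
          omega
        rw [Matrix.trace, Finset.sum_eq_single i (fun b _ hb => absurd (hij b) hb)
          (fun h => absurd (Finset.mem_univ i) h)] at htr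
        rw [hij j]
        exact htr
      rw [hz0]
      exact zero_mem J
    · exfalso
      obtain ⟨U, V, hUV⟩ := exists_unitary_not_commute hn
      -- If every `Sₖ` is scalar, the commutative algebra generated by `S₀` is stable under left
      -- multiplication by all of them, so it contains every reachable matrix. Then `U(n)` would be
      -- commutative, which fails for `n ≥ 2`.
      let A := Algebra.adjoin ℂ {skew H₀}
      let J' : Submodule ℝ (Matrix (Fin n) (Fin n) ℂ) :=
        (Subalgebra.toSubmodule A).restrictScalars ℝ
      have hmem : ∀ W : Matrix.unitaryGroup (Fin n) ℂ, (W : Matrix (Fin n) (Fin n) ℂ) ∈ A := by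
        refine unitary_mem_of_controllable hctrl J' (one_mem A) (fun y hy => ?_)
          (fun k y hy => ?_)
        · exact mul_mem (s := A) (Algebra.self_mem_adjoin_singleton ℂ _) hy
        · obtain ⟨c, hc⟩ := hscal k
          rw [hc, Matrix.smul_mul, Matrix.one_mul]
          exact A.smul_mem hy c
      refine hUV ?_
      have h1 : Commute (skew H₀) (V : Matrix (Fin n) (Fin n) ℂ) :=
        Algebra.commute_of_mem_adjoin_self (hmem V)
      exact (Algebra.commute_of_mem_adjoin_singleton_of_commute (hmem U) h1.symm).symm
  · push Not at hscal
    obtain ⟨k, hk'⟩ := hscal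
    exact traceless_skew_mem J
      (fun U y hy => conj_mem_of_controllable hH₀ hH hctrl J h₀ hk U hy) (hS k)
      (skew_conjTranspose (hH k)) hk' hz htr

/-- If moreover one of the `H_k` has nonzero trace, it contains all skew-Hermitian matrices. -/
theorem skew_mem_of_controllable {H₀ : Matrix (Fin n) (Fin n) ℂ}
    {H : Fin m → Matrix (Fin n) (Fin n) ℂ} (hH₀ : H₀.IsHermitian) (hH : ∀ k, (H k).IsHermitian)
    (hctrl : Controllable H₀ H) (J : Submodule ℝ (Matrix (Fin n) (Fin n) ℂ))
    (hS : ∀ k, skew (H k) ∈ J) (h₀ : ∀ y ∈ J, bracketRight (skew H₀) y ∈ J)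
    (hk : ∀ k, ∀ y ∈ J, bracketRight (skew (H k)) y ∈ J) {k : Fin m} (htr : (H k).trace ≠ 0)
    {z : Matrix (Fin n) (Fin n) ℂ} (hz : zᴴ = -z) : z ∈ J := by
  have hre : ∀ w : Matrix (Fin n) (Fin n) ℂ, wᴴ = -w → w.trace = Complex.I * (w.trace.im : ℂ) := by
    intro w hw
    have h := Matrix.trace_conjTranspose w
    rw [hw, Matrix.trace_neg] at h
    have h2 := congrArg Complex.re h
    simp only [Complex.neg_re, RCLike.star_def, Complex.conj_re] at h2
    apply Complex.ext
    · simp; linarith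
    · simp
  have hsk := skew_conjTranspose (hH k)
  have hne : (skew (H k)).trace ≠ 0 := by
    simpa [skew] using htr
  set a := (skew (H k)).trace.im
  have ha : a ≠ 0 := fun h => hne (by rw [hre _ hsk]; simp [a, h] at *)
  -- Traces of skew-Hermitian matrices are purely imaginary, so a real multiple of `skew (H k)`
  -- removes the trace of `z`.
  have hz' : z - (z.trace.im / a) • skew (H k) ∈ J := by
    refine traceless_skew_mem_of_controllable hH₀ hH hctrl J hS h₀ hk ?_ ?_
    · rw [Matrix.conjTranspose_sub, Matrix.conjTranspose_smul, hsk, hz, star_trivial, smul_neg,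
        neg_sub, sub_neg_eq_add]
      abel
    · rw [Matrix.trace_sub, Matrix.trace_smul, hre _ hsk, hre _ hz, Complex.real_smul]
      have ha' : (a : ℂ) ≠ 0 := by exact_mod_cast ha
      push_cast
      simp only [Complex.mul_im, Complex.I_re, Complex.I_im, Complex.ofReal_re, Complex.ofReal_im]
      change _ - _ * (Complex.I * (a : ℂ)) = 0
      field_simp
      simp
  have := add_mem hz' (J.smul_mem (z.trace.im / a) (hS k))
  rwa [sub_add_cancel] at this

end Matrices

/-! ### Iterated brackets along a reference trajectory -/

section Jets

variable {n m : ℕ}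

/-- The jet of infinite order at time `t` of an input defined on `[0, T]`. -/
def fullJet (T : ℝ) (u : Fin m → ℝ → ℝ) (t : ℝ) : Fin m × ℕ → ℝ :=
  fun p => iteratedDerivWithin p.2 (u p.1) (Icc 0 T) t

/-- This links the algebra to the trajectories. The order of the variables of `f` is strictly below
`M`, which leaves one more derivative of the input available. -/
theorem hasDerivWithinAt_eval_fullJet {T : ℝ} (hT : 0 < T) {M : ℕ} {u : Fin m → ℝ → ℝ}
    (hu : ∀ k, ContDiffOn ℝ M (u k) (Icc 0 T)) {f : JetPoly (Fin m)}
    (hf : f ∈ jetSubalgebra (Fin m) M) {t : ℝ} (ht : t ∈ Icc 0 T) :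
    HasDerivWithinAt (fun s => MvPolynomial.eval (fullJet T u s) f)
      (MvPolynomial.eval (fullJet T u t) (totalDeriv (Fin m) f)) (Icc 0 T) t := by
  rw [jetSubalgebra, MvPolynomial.supported] at hf
  induction hf using Algebra.adjoin_induction with
  | mem x hx =>
    obtain ⟨p, hp, rfl⟩ := hx
    simp only [totalDeriv_X, MvPolynomial.eval_X, fullJet]
    rw [iteratedDerivWithin_succ]
    exact ((hu p.1).differentiableOn_iteratedDerivWithin (by exact_mod_cast hp)
      (uniqueDiffOn_Icc hT) t ht).hasDerivWithinAt
  | algebraMap r =>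
    simpa [MvPolynomial.algebraMap_eq] using hasDerivWithinAt_const t (Icc 0 T) r
  | add x y _ _ hx hy =>
    simp only [map_add]
    exact hx.add hy
  | mul x y _ _ hx hy =>
    simp only [map_mul, Derivation.leibniz, smul_eq_mul, map_add]
    refine (hx.mul hy).congr_deriv ?_
    ring

/-- The linear form `y ↦ Re tr(N y)`. -/
def traceForm (N : Matrix (Fin n) (Fin n) ℂ) : Matrix (Fin n) (Fin n) ℂ →ₗ[ℝ] ℝ :=
  Complex.reLm ∘ₗ (Matrix.traceLinearMap (Fin n) ℝ ℂ) ∘ₗ LinearMap.mulLeft ℝ N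

theorem traceForm_apply (N y : Matrix (Fin n) (Fin n) ℂ) :
    traceForm N y = (Matrix.trace (N * y)).re := rfl

/-- The linear map `y ↦ P† y P`. -/
def conjMap (P : Matrix (Fin n) (Fin n) ℂ) :
    Matrix (Fin n) (Fin n) ℂ →ₗ[ℝ] Matrix (Fin n) (Fin n) ℂ :=
  LinearMap.mulRight ℝ P ∘ₗ LinearMap.mulLeft ℝ Pᴴ

theorem conjMap_apply (P y : Matrix (Fin n) (Fin n) ℂ) : conjMap P y = Pᴴ * y * P := rfl

theorem hasDerivWithinAt_matrix_of_coord {ι : Type*} [Fintype ι]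
    (φ : (ι → ℝ) →ₗ[ℝ] Matrix (Fin n) (Fin n) ℂ) {c : ℝ → ι → ℝ} {c' : ι → ℝ} {s : Set ℝ}
    {t : ℝ} (h : ∀ i, HasDerivWithinAt (fun s => c s i) (c' i) s t) :
    HasDerivWithinAt (fun s => φ (c s)) (φ c') s t := by
  let _ : NormedAddCommGroup (Matrix (Fin n) (Fin n) ℂ) := Matrix.normedAddCommGroup
  let _ : NormedSpace ℝ (Matrix (Fin n) (Fin n) ℂ) := Matrix.normedSpace
  exact (LinearMap.toContinuousLinearMap φ).hasFDerivAt.comp_hasDerivWithinAt t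
    (hasDerivWithinAt_pi.2 h)

variable (H₀ : Matrix (Fin n) (Fin n) ℂ) (H : Fin m → Matrix (Fin n) (Fin n) ℂ)

/-- The basis of the real space of complex matrices that is used for coordinates. -/
def matBasis (n : ℕ) : Module.Basis (Fin (Module.finrank ℝ (Matrix (Fin n) (Fin n) ℂ))) ℝ
    (Matrix (Fin n) (Fin n) ℂ) := Module.finBasis ℝ _

/-- The bracket with `S` in coordinates. -/
def bracketMatrix (S : Matrix (Fin n) (Fin n) ℂ) :=
  LinearMap.toMatrix (matBasis n) (matBasis n) (bracketRight S)

theorem bracketMatrix_mulVec (S y : Matrix (Fin n) (Fin n) ℂ) :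
    bracketMatrix S *ᵥ (matBasis n).equivFun y = (matBasis n).equivFun (bracketRight S y) :=
  LinearMap.toMatrix_mulVec_repr (matBasis n) (matBasis n) (bracketRight S) y

/-- The coordinates of the iterated brackets of order `j` with the generic generator. -/
def iterBracket (k : Fin m) (j : ℕ) :
    Fin (Module.finrank ℝ (Matrix (Fin n) (Fin n) ℂ)) → JetPoly (Fin m) :=
  iterVec (bracketMatrix (skew H₀)) (fun k => bracketMatrix (skew (H k)))
    (fun k => (matBasis n).equivFun (skew (H k))) k j

/-- The iterated bracket of order `j` at a jet. -/
def bracketAt (v : Fin m × ℕ → ℝ) (k : Fin m) (j : ℕ) : Matrix (Fin n) (Fin n) ℂ :=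
  (matBasis n).equivFun.symm (evalVec v (iterBracket H₀ H k j))

theorem bracketAt_zero (v : Fin m × ℕ → ℝ) (k : Fin m) : bracketAt H₀ H v k 0 = skew (H k) := by
  rw [bracketAt, LinearEquiv.symm_apply_eq]
  ext1 i
  simp [evalVec, iterBracket, iterVec]

theorem evalVec_mulVec_map_C {κ ι : Type*} [Fintype ι] (v : κ × ℕ → ℝ) (b : Matrix ι ι ℝ)
    (w : ι → JetPoly κ) : evalVec v (b.map MvPolynomial.C *ᵥ w) = b *ᵥ evalVec v w := by
  ext1 i
  simp [evalVec, Matrix.mulVec, dotProduct]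

theorem bracketAt_succ (v : Fin m × ℕ → ℝ) (k : Fin m) (j : ℕ) :
    bracketAt H₀ H v k (j + 1) =
      (matBasis n).equivFun.symm
          (evalVec v fun i => totalDeriv (Fin m) (iterBracket H₀ H k j i)) +
        bracketRight (generator H₀ H fun k => v (k, 0)) (bracketAt H₀ H v k j) := by
  have hcov : evalVec v (iterBracket H₀ H k (j + 1)) =
      evalVec v (fun i => totalDeriv (Fin m) (iterBracket H₀ H k j i)) +
        (bracketMatrix (skew H₀) *ᵥ evalVec v (iterBracket H₀ H k j) +
          ∑ l, v (l, 0) • (bracketMatrix (skew (H l)) *ᵥ evalVec v (iterBracket H₀ H k j))) := by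
    simp only [← evalVec_mulVec_map_C]
    ext1 i
    simp only [iterBracket, iterVec, covDeriv, driftMatrix, Matrix.add_mulVec, Matrix.sum_mulVec,
      Matrix.smul_mulVec, evalVec, Pi.add_apply, Finset.sum_apply, Pi.smul_apply, map_add, map_sum,
      smul_eq_mul, map_mul, MvPolynomial.eval_X]
  have hy : evalVec v (iterBracket H₀ H k j) =
      (matBasis n).equivFun (bracketAt H₀ H v k j) := by
    rw [bracketAt, LinearEquiv.apply_symm_apply]
  rw [bracketAt, hcov, hy]
  simp only [bracketMatrix_mulVec]
  rw [map_add, map_add, map_sum, LinearEquiv.symm_apply_apply]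
  congr 1
  simp only [map_smul, LinearEquiv.symm_apply_apply, bracketRight_apply, generator, mul_add,
    add_mul, Finset.mul_sum, Finset.sum_mul, Matrix.mul_smul, Matrix.smul_mul, smul_sub,
    Finset.sum_sub_distrib]
  abel

variable {H₀ H}

/-- A linear form that vanishes on the `X† S_k X` along a reference trajectory vanishes on the
conjugates of the iterated brackets. -/
theorem traceForm_bracketAt_eq_zero (hH₀ : H₀.IsHermitian) (hH : ∀ k, (H k).IsHermitian)
    {T : ℝ} (hT : 0 < T) {M : ℕ} {u : Fin m → ℝ → ℝ} (hu : ∀ k, ContDiffOn ℝ M (u k) (Icc 0 T))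
    {X₀ : Matrix.unitaryGroup (Fin n) ℂ} {X : ℝ → Matrix.unitaryGroup (Fin n) ℂ}
    (hX : IsReferenceTrajectory H₀ H T u X₀ X) {N : Matrix (Fin n) (Fin n) ℂ}
    (hN : ∀ k, ∀ t ∈ Icc 0 T, traceForm N (skewTilde (H k) (X t)) = 0) (k : Fin m) :
    ∀ j ≤ M, ∀ t ∈ Icc 0 T,
      traceForm N (conjMap (X t : Matrix (Fin n) (Fin n) ℂ)
        (bracketAt H₀ H (fullJet T u t) k j)) = 0 := by
  intro j
  induction j with
  | zero =>
    intro _ t ht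
    rw [bracketAt_zero]
    exact hN k t ht
  | succ j ih =>
    intro hj t ht
    have hB := hasDerivWithinAt_matrix_of_coord (s := Icc 0 T) (t := t)
      (matBasis n).equivFun.symm.toLinearMap
      (c := fun s => evalVec (fullJet T u s) (iterBracket H₀ H k j))
      (fun i => hasDerivWithinAt_eval_fullJet hT hu
        (jetSubalgebra_mono (by omega) (iterVec_mem _ _ _ k j i)) ht)
    have hXt := hX.2 t ht
    have hd := hasDerivWithinAt_linearMap (traceForm N) (hasDerivWithinAt_matrix_mul
      (hasDerivWithinAt_matrix_mul (hasDerivWithinAt_conjTranspose hXt) hB) hXt)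
    have h0 : HasDerivWithinAt (fun _ : ℝ => (0 : ℝ)) 0 (Icc 0 T) t :=
      hasDerivWithinAt_const t _ 0
    have hd0 := h0.congr (f₁ := fun s => traceForm N ((X s : Matrix (Fin n) (Fin n) ℂ)ᴴ *
      (matBasis n).equivFun.symm.toLinearMap (evalVec (fullJet T u s) (iterBracket H₀ H k j)) *
        (X s : Matrix (Fin n) (Fin n) ℂ)))
      (fun s hs => ih (by omega) s hs) (ih (by omega) t ht)
    -- The same function is differentiated by the product rule and as the zero function. The factors
    -- `X` and `X†` contribute the bracket with the generator, which with the total derivative forms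
    -- the bracket of order `j + 1`.
    have heq := (uniqueDiffOn_Icc hT t ht).eq_deriv _ hd hd0
    rw [← heq, bracketAt_succ, conjMap_apply]
    congr 1
    have hv : (fun l => fullJet T u t (l, 0)) = fun l => u l t := by
      ext1 l
      simp [fullJet]
    rw [hv, Matrix.conjTranspose_mul, generator_conjTranspose hH₀ hH]
    change _ = (_ * bracketAt H₀ H (fullJet T u t) k j +
      (X t : Matrix (Fin n) (Fin n) ℂ)ᴴ * (matBasis n).equivFun.symm
        (evalVec (fullJet T u t) fun i => totalDeriv (Fin m) (iterBracket H₀ H k j i))) * _ +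
      (X t : Matrix (Fin n) (Fin n) ℂ)ᴴ * bracketAt H₀ H (fullJet T u t) k j * _
    simp only [bracketRight_apply, mul_add, add_mul, mul_sub, sub_mul, Matrix.mul_assoc,
      Matrix.neg_mul, Matrix.mul_neg]
    abel

/-- The observability property of the generic inputs. -/
theorem exists_observability_polynomial (hH₀ : H₀.IsHermitian) (hH : ∀ k, (H k).IsHermitian)
    (hctrl : Controllable H₀ H) :
    ∃ (M₀ : ℕ) (Q : MvPolynomial (Fin m × Fin (M₀ + 1)) ℝ), 1 ≤ M₀ ∧ Q ≠ 0 ∧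
      ∀ T : ℝ, 0 < T → ∀ u : Fin m → ℝ → ℝ, (∀ k, ContDiffOn ℝ M₀ (u k) (Icc 0 T)) →
      ∀ t₀ ∈ Icc 0 T, MvPolynomial.eval (inputJet M₀ T u t₀) Q ≠ 0 →
      ∀ (X₀ : Matrix.unitaryGroup (Fin n) ℂ) (X : ℝ → Matrix.unitaryGroup (Fin n) ℂ),
      IsReferenceTrajectory H₀ H T u X₀ X → ∀ N : Matrix (Fin n) (Fin n) ℂ,
      (∀ k, ∀ t ∈ Icc 0 T, traceForm N (skewTilde (H k) (X t)) = 0) →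
      ∀ z : Matrix (Fin n) (Fin n) ℂ, zᴴ = -z → (z.trace = 0 ∨ ∃ k, (H k).trace ≠ 0) →
      traceForm N (conjMap (X t₀ : Matrix (Fin n) (Fin n) ℂ) z) = 0 := by
  obtain ⟨N₁, Q₀, hQ₀, hspan⟩ := exists_generic_polynomial (bracketMatrix (skew H₀))
    (fun k => bracketMatrix (skew (H k))) (fun k => (matBasis n).equivFun (skew (H k)))
  obtain ⟨N₂, hN₂⟩ := exists_mem_jetSubalgebra Q₀
  -- `N₁` covers the required differentiations and `N₂` the jet variables in `Q₀`; the extra `1`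
  -- ensures `1 ≤ M₀`, which the root count for seeds uses.
  let M₀ := N₁ + N₂ + 1
  let ρ : Fin m × Fin (M₀ + 1) → Fin m × ℕ := fun p => (p.1, p.2)
  obtain ⟨Q, hQ⟩ : ∃ Q : MvPolynomial (Fin m × Fin (M₀ + 1)) ℝ, MvPolynomial.rename ρ Q = Q₀ := by
    refine MvPolynomial.exists_rename_eq_of_vars_subset_range Q₀ ρ ?_ fun p hp => ?_
    · rintro ⟨k, j⟩ ⟨k', j'⟩ h
      simp only [ρ, Prod.mk.injEq, Fin.val_inj] at h
      rw [h.1, h.2]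
    · have h := MvPolynomial.mem_supported.1 hN₂ hp
      have h' : p.2 < N₂ := h
      exact ⟨(p.1, ⟨p.2, by omega⟩), rfl⟩
  refine ⟨M₀, Q, by omega, ?_, ?_⟩
  · rintro rfl
    exact hQ₀ (by rw [← hQ, map_zero])
  intro T hT u hu t₀ ht₀ hne X₀ X hX N hN z hz htr
  have hne' : MvPolynomial.eval (fullJet T u t₀) Q₀ ≠ 0 := by
    rw [← hQ, MvPolynomial.eval_rename]
    exact hne
  let J : Submodule ℝ (Matrix (Fin n) (Fin n) ℂ) :=
    (realIterModule (bracketMatrix (skew H₀)) (fun k => bracketMatrix (skew (H k)))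
      (fun k => (matBasis n).equivFun (skew (H k)))).comap (matBasis n).equivFun.toLinearMap
  have hS : ∀ k, skew (H k) ∈ J := fun k => vec_mem_realIterModule _ _ _ k
  have h₀ : ∀ y ∈ J, bracketRight (skew H₀) y ∈ J := fun y hy => by
    have := drift_mulVec_mem_realIterModule _ _ _ (x := (matBasis n).equivFun y) hy
    rwa [bracketMatrix_mulVec] at this
  have hk : ∀ k, ∀ y ∈ J, bracketRight (skew (H k)) y ∈ J := fun k y hy => by
    have := control_mulVec_mem_realIterModule _ _ _ k (x := (matBasis n).equivFun y) hy
    rwa [bracketMatrix_mulVec] at this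
  have hzJ : z ∈ J := by
    rcases htr with htr | ⟨k, htr⟩
    · exact traceless_skew_mem_of_controllable hH₀ hH hctrl J hS h₀ hk hz htr
    · exact skew_mem_of_controllable hH₀ hH hctrl J hS h₀ hk htr hz
  have hzs := hspan _ hne' hzJ
  let φ : (Fin (Module.finrank ℝ (Matrix (Fin n) (Fin n) ℂ)) → ℝ) →ₗ[ℝ] ℝ :=
    traceForm N ∘ₗ conjMap (X t₀ : Matrix (Fin n) (Fin n) ℂ) ∘ₗ
      (matBasis n).equivFun.symm.toLinearMap
  have hker : Submodule.span ℝ {x | ∃ k, ∃ j < N₁, x = evalVec (fullJet T u t₀)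
      (iterVec (bracketMatrix (skew H₀)) (fun k => bracketMatrix (skew (H k)))
        (fun k => (matBasis n).equivFun (skew (H k))) k j)} ≤ LinearMap.ker φ := by
    rw [Submodule.span_le]
    rintro _ ⟨k, j, hj, rfl⟩
    exact traceForm_bracketAt_eq_zero hH₀ hH hT hu hX hN k j (by omega) t₀ ht₀
  have hfin := hker hzs
  rw [LinearMap.mem_ker] at hfin
  simpa [φ] using hfin

end Jets

/-! ### The squared Frobenius norm -/

section Frobenius

/-- The squared Frobenius norm. -/
def frob {a b : ℕ} (N : Matrix (Fin a) (Fin b) ℂ) : ℝ := ∑ i, ∑ j, ‖N i j‖ ^ 2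

variable {a b c n : ℕ}

theorem frob_nonneg (N : Matrix (Fin a) (Fin b) ℂ) : 0 ≤ frob N :=
  Finset.sum_nonneg fun _ _ => Finset.sum_nonneg fun _ _ => sq_nonneg _

theorem frob_eq_trace (N : Matrix (Fin a) (Fin b) ℂ) : frob N = (trace (Nᴴ * N)).re := by
  simp only [frob, Matrix.trace, Matrix.diag_apply, Matrix.mul_apply, Matrix.conjTranspose_apply,
    Complex.re_sum]
  rw [Finset.sum_comm]
  refine Finset.sum_congr rfl fun j _ => Finset.sum_congr rfl fun i _ => ?_
  rw [RCLike.star_def, ← Complex.normSq_eq_conj_mul_self, Complex.ofReal_re,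
    Complex.normSq_eq_norm_sq]

theorem norm_sq_le_frob (N : Matrix (Fin a) (Fin b) ℂ) (i : Fin a) (j : Fin b) :
    ‖N i j‖ ^ 2 ≤ frob N :=
  (Finset.single_le_sum (f := fun j => ‖N i j‖ ^ 2) (fun _ _ => sq_nonneg _)
    (Finset.mem_univ j)).trans
    (Finset.single_le_sum (f := fun i => ∑ j, ‖N i j‖ ^ 2)
      (fun _ _ => Finset.sum_nonneg fun _ _ => sq_nonneg _) (Finset.mem_univ i))

theorem frob_eq_zero {N : Matrix (Fin a) (Fin b) ℂ} (h : frob N = 0) : N = 0 := by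
  ext i j
  have := norm_sq_le_frob N i j
  rw [h] at this
  simpa using le_antisymm this (sq_nonneg _)

theorem frob_smul (r : ℂ) (N : Matrix (Fin a) (Fin b) ℂ) : frob (r • N) = ‖r‖ ^ 2 * frob N := by
  simp [frob, Finset.mul_sum, mul_pow]

theorem frob_real_smul (r : ℝ) (N : Matrix (Fin a) (Fin b) ℂ) :
    frob (r • N) = r ^ 2 * frob N := by
  simp [frob, Finset.mul_sum, mul_pow]

theorem frob_add_le (M N : Matrix (Fin a) (Fin b) ℂ) :
    frob (M + N) ≤ 2 * frob M + 2 * frob N := by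
  simp only [frob, Finset.mul_sum, ← Finset.sum_add_distrib]
  refine Finset.sum_le_sum fun i _ => Finset.sum_le_sum fun j _ => ?_
  have h := norm_add_le (M i j) (N i j)
  have h2 : ‖(M + N) i j‖ ^ 2 ≤ (‖M i j‖ + ‖N i j‖) ^ 2 :=
    pow_le_pow_left₀ (norm_nonneg _) h 2
  nlinarith [sq_nonneg (‖M i j‖ - ‖N i j‖)]

theorem frob_mul_le (M : Matrix (Fin a) (Fin b) ℂ) (N : Matrix (Fin b) (Fin c) ℂ) :
    frob (M * N) ≤ frob M * frob N := by
  have h : ∀ i j, ‖(M * N) i j‖ ^ 2 ≤ (∑ k, ‖M i k‖ ^ 2) * ∑ k, ‖N k j‖ ^ 2 := by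
    intro i j
    rw [Matrix.mul_apply]
    refine le_trans (pow_le_pow_left₀ (norm_nonneg _) (norm_sum_le _ _) 2) ?_
    simp only [norm_mul]
    exact Finset.sum_mul_sq_le_sq_mul_sq _ _ _
  calc frob (M * N) ≤ ∑ i, ∑ j, (∑ k, ‖M i k‖ ^ 2) * ∑ k, ‖N k j‖ ^ 2 :=
        Finset.sum_le_sum fun i _ => Finset.sum_le_sum fun j _ => h i j
    _ = frob M * frob N := by
        rw [frob, frob, Finset.sum_mul, Finset.sum_comm (s := (Finset.univ : Finset (Fin b)))]
        simp only [Finset.mul_sum]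

theorem frob_conj (U : Matrix.unitaryGroup (Fin n) ℂ) (N : Matrix (Fin n) (Fin n) ℂ) :
    frob ((U : Matrix (Fin n) (Fin n) ℂ) * N * (U : Matrix (Fin n) (Fin n) ℂ)ᴴ) = frob N := by
  rw [frob_eq_trace, frob_eq_trace]
  simp only [Matrix.conjTranspose_mul, Matrix.conjTranspose_conjTranspose]
  rw [Matrix.trace_mul_comm, ← Matrix.trace_mul_comm]
  have : (U : Matrix (Fin n) (Fin n) ℂ) * (Nᴴ * (U : Matrix (Fin n) (Fin n) ℂ)ᴴ) *
      (U * N * (U : Matrix (Fin n) (Fin n) ℂ)ᴴ) =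
        U * (Nᴴ * N) * (U : Matrix (Fin n) (Fin n) ℂ)ᴴ := by
    simp only [Matrix.mul_assoc]
    rw [← Matrix.mul_assoc (U : Matrix (Fin n) (Fin n) ℂ)ᴴ (U : Matrix (Fin n) (Fin n) ℂ),
      unitary_conjTranspose_mul, Matrix.one_mul]
  rw [this, Matrix.trace_mul_comm, ← Matrix.mul_assoc, unitary_conjTranspose_mul, Matrix.one_mul]

end Frobenius

/-! ### Estimates of the Lyapunov function -/

section Lyapunov

variable {n d : ℕ} {E : Matrix (Fin n) (Fin d) ℂ}

theorem re_trace_conjTranspose (A : Matrix (Fin n) (Fin n) ℂ) :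
    (trace Aᴴ).re = (trace A).re := by
  rw [Matrix.trace_conjTranspose, RCLike.star_def, Complex.conj_re]

theorem conjTranspose_mul_self_sub_one (hE : Eᴴ * E = 1) {X : Matrix (Fin n) (Fin n) ℂ}
    (hX : Xᴴ * X = 1) :
    ((X - 1) * E)ᴴ * ((X - 1) * E) =
      (1 + 1 : Matrix (Fin d) (Fin d) ℂ) - (Eᴴ * X * E + (Eᴴ * X * E)ᴴ) := by
  simp only [Matrix.conjTranspose_mul, Matrix.conjTranspose_sub,
    Matrix.sub_mul, Matrix.mul_sub, Matrix.mul_assoc, Matrix.one_mul,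
    Matrix.conjTranspose_conjTranspose]
  rw [← Matrix.mul_assoc Xᴴ X, hX, Matrix.one_mul, hE]
  abel

theorem lyapunov_eq_frob (hE : Eᴴ * E = 1) {X : Matrix (Fin n) (Fin n) ℂ}
    (hX : Xᴴ * X = 1) :
    lyapunov E X =
      frob ((X - 1) * E) := by
  rw [frob_eq_trace, conjTranspose_mul_self_sub_one hE hX, Matrix.trace_sub, Matrix.trace_add,
    Matrix.trace_add, Complex.sub_re, Complex.add_re, Complex.add_re,
    re_trace_conjTranspose, Matrix.trace_one, lyapunov]
  simp
  ring

theorem lyapunov_nonneg (hE : Eᴴ * E = 1) (X : Matrix.unitaryGroup (Fin n) ℂ) :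
    0 ≤ lyapunov E (X : Matrix (Fin n) (Fin n) ℂ) := by
  rw [lyapunov_eq_frob hE (unitary_conjTranspose_mul X)]
  exact frob_nonneg _

theorem lyapunov_le_of_mem_partialBall (hE : Eᴴ * E = 1) {c : ℝ}
    {X : Matrix.unitaryGroup (Fin n) ℂ} (hX : X ∈ partialBall E 1 c) :
    lyapunov E (X : Matrix (Fin n) (Fin n) ℂ) ≤ c ^ 2 := by
  have h : Real.sqrt (frob (((X : Matrix (Fin n) (Fin n) ℂ) - 1) * E)) ≤ c := hX
  rw [lyapunov_eq_frob hE (unitary_conjTranspose_mul X)]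
  have h2 := pow_le_pow_left₀ (Real.sqrt_nonneg _) h 2
  rwa [Real.sq_sqrt (frob_nonneg _)] at h2

/-- Twice the skew-Hermitian part of `X E E†`. -/
def skewPart (E : Matrix (Fin n) (Fin d) ℂ) (X : Matrix (Fin n) (Fin n) ℂ) :
    Matrix (Fin n) (Fin n) ℂ := X * (E * Eᴴ) - E * Eᴴ * Xᴴ

theorem skewPart_conjTranspose (X : Matrix (Fin n) (Fin n) ℂ) :
    (skewPart E X)ᴴ = -skewPart E X := by
  simp [skewPart, Matrix.conjTranspose_mul]

theorem traceForm_skewPart (X y : Matrix (Fin n) (Fin n) ℂ) (hy : yᴴ = -y) :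
    traceForm (skewPart E X) y = 2 * (trace (Eᴴ * y * X * E)).re := by
  have h1 : trace (X * (E * Eᴴ) * y) = trace (Eᴴ * y * X * E) := by
    rw [Matrix.trace_mul_comm, ← Matrix.mul_assoc, ← Matrix.mul_assoc, Matrix.trace_mul_comm,
      ← Matrix.mul_assoc, ← Matrix.mul_assoc]
  have h2 : (trace (E * Eᴴ * Xᴴ * y)).re = -(trace (X * (E * Eᴴ) * y)).re := by
    rw [← re_trace_conjTranspose]
    simp only [Matrix.conjTranspose_mul, Matrix.conjTranspose_conjTranspose, hy]
    rw [Matrix.trace_mul_comm, Matrix.mul_neg, Matrix.trace_neg, Complex.neg_re]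
  rw [traceForm_apply, skewPart, Matrix.sub_mul, Matrix.trace_sub, Complex.sub_re, h2, h1]
  ring

theorem frob_skewPart (hE : Eᴴ * E = 1) {X : Matrix (Fin n) (Fin n) ℂ}
    (hX : Xᴴ * X = 1) :
    frob (skewPart E X) =
      2 * (d : ℝ) - 2 * (trace ((Eᴴ * X * E) * (Eᴴ * X * E))).re := by
  have hPP : E * Eᴴ * (E * Eᴴ) = E * Eᴴ := by
    rw [Matrix.mul_assoc, ← Matrix.mul_assoc Eᴴ, hE, Matrix.one_mul]
  have htP : trace (E * Eᴴ) = (d : ℂ) := by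
    rw [Matrix.trace_mul_comm, hE, Matrix.trace_one, Fintype.card_fin]
  rw [frob_eq_trace, skewPart_conjTranspose]
  have h1 : trace (X * (E * Eᴴ) * (X * (E * Eᴴ))) =
      trace ((Eᴴ * X * E) * (Eᴴ * X * E)) := by
    calc _ = trace ((X * (E * Eᴴ) * X * E) * Eᴴ) := by
          simp only [Matrix.mul_assoc]
      _ = _ := by
          rw [Matrix.trace_mul_comm]
          simp only [Matrix.mul_assoc]
  have h2 : trace (X * (E * Eᴴ) *
      (E * Eᴴ * Xᴴ)) = (d : ℂ) := by
    rw [Matrix.trace_mul_comm]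
    have : E * Eᴴ * Xᴴ * (X * (E * Eᴴ)) = E * Eᴴ := by
      rw [Matrix.mul_assoc (E * Eᴴ), ← Matrix.mul_assoc Xᴴ,
        hX, Matrix.one_mul, hPP]
    rw [this, htP]
  have h3 : trace (E * Eᴴ * Xᴴ * (X * (E * Eᴴ))) = (d : ℂ) := by
    rw [Matrix.trace_mul_comm, h2]
  have h4 : (trace (E * Eᴴ * Xᴴ *
      (E * Eᴴ * Xᴴ))).re =
        (trace ((Eᴴ * X * E) * (Eᴴ * X * E))).re := by
    rw [← h1, ← re_trace_conjTranspose]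
    simp only [Matrix.conjTranspose_mul, Matrix.conjTranspose_conjTranspose]
  simp only [skewPart, Matrix.neg_mul, Matrix.trace_neg, Matrix.sub_mul, Matrix.mul_sub,
    Matrix.trace_sub, Complex.neg_re, Complex.sub_re]
  rw [h1, h2, h3, h4]
  simp
  ring

/-- Splitting `W` into Hermitian part `A` and skew-Hermitian part `B` gives `Re tr (W W) = ‖A‖² -
‖B‖²`. -/
theorem re_trace_sq_le {W : Matrix (Fin d) (Fin d) ℂ} :
    (trace (W * W)).re ≤ frob ((1 / 2 : ℝ) • (W + Wᴴ)) := by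
  have h := frob_nonneg (W - Wᴴ)
  rw [frob_real_smul, frob_eq_trace]
  rw [frob_eq_trace] at h
  have h1 : (trace (Wᴴ * Wᴴ)).re = (trace (W * W)).re := by
    rw [← re_trace_conjTranspose, Matrix.conjTranspose_mul, Matrix.conjTranspose_conjTranspose]
  simp only [Matrix.conjTranspose_add, Matrix.conjTranspose_sub,
    Matrix.conjTranspose_conjTranspose, Matrix.add_mul, Matrix.mul_add, Matrix.sub_mul,
    Matrix.mul_sub, Matrix.trace_add, Matrix.trace_sub, Complex.add_re, Complex.sub_re, h1] at h ⊢
  linarith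

/-- With `Z = (X - 1) E`, the Hermitian part of `W = E† X E` is `1 - Z† Z / 2`, of squared norm `d -
V + ‖Z† Z‖² / 4 ≤ d - V + V² / 4`. Inserting this in `‖skewPart‖² = 2 d - 2 Re tr (W W)` gives the
bound. -/
theorem lyapunov_le_frob_skewPart (hE : Eᴴ * E = 1) {X : Matrix (Fin n) (Fin n) ℂ}
    (hX : Xᴴ * X = 1) :
    lyapunov E X *
      (2 - lyapunov E X / 2) ≤
        frob (skewPart E X) := by
  set V := lyapunov E X with hV
  set W := Eᴴ * X * E with hW
  set Z := (X - 1) * E with hZ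
  have hVZ : V = frob Z := lyapunov_eq_frob hE hX
  have hZZ : Zᴴ * Z = (1 + 1 : Matrix (Fin d) (Fin d) ℂ) - (W + Wᴴ) :=
    conjTranspose_mul_self_sub_one hE hX
  have hA : (1 / 2 : ℝ) • (W + Wᴴ) = 1 - (1 / 2 : ℝ) • (Zᴴ * Z) := by
    rw [hZZ, smul_sub, ← two_smul ℝ (1 : Matrix (Fin d) (Fin d) ℂ), smul_smul]
    norm_num
  have hD : frob (1 - (1 / 2 : ℝ) • (Zᴴ * Z)) = d - V + 1 / 4 * frob (Zᴴ * Z) := by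
    have hs : (Zᴴ * Z)ᴴ = Zᴴ * Z := by
      rw [Matrix.conjTranspose_mul, Matrix.conjTranspose_conjTranspose]
    rw [hVZ, frob_eq_trace, frob_eq_trace Z, frob_eq_trace (Zᴴ * Z)]
    simp only [Matrix.conjTranspose_sub, Matrix.conjTranspose_smul, Matrix.conjTranspose_one, hs,
      star_trivial, sub_mul, mul_sub, Matrix.one_mul, Matrix.mul_one, Matrix.trace_sub,
      Matrix.trace_one, Complex.sub_re, Matrix.smul_mul, Matrix.mul_smul, Matrix.trace_smul,
      Complex.real_smul, Complex.re_ofReal_mul, Fintype.card_fin, Complex.natCast_re]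
    ring
  have hsub : frob (Zᴴ * Z) ≤ V * V := by
    have hc : frob Zᴴ = frob Z := by
      simp only [frob, Matrix.conjTranspose_apply, norm_star]
      exact Finset.sum_comm
    rw [hVZ]
    simpa [hc] using frob_mul_le Zᴴ Z
  have h1 := re_trace_sq_le (W := W)
  rw [hA, hD] at h1
  rw [frob_skewPart hE hX]
  linarith

/-- The skew-Hermitian matrices, with trace zero unless `τ` holds. -/
def skewSpace (n : ℕ) (τ : Prop) : Submodule ℝ (Matrix (Fin n) (Fin n) ℂ) where
  carrier := {z | zᴴ = -z ∧ (z.trace = 0 ∨ τ)}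
  zero_mem' := by simp
  add_mem' := by
    rintro y z ⟨hy, hy'⟩ ⟨hz, hz'⟩
    refine ⟨by rw [Matrix.conjTranspose_add, hy, hz, neg_add], ?_⟩
    by_cases hτ : τ
    · exact Or.inr hτ
    · left
      rw [Matrix.trace_add, hy'.resolve_right hτ, hz'.resolve_right hτ, add_zero]
  smul_mem' := by
    rintro c z ⟨hz, hz'⟩
    refine ⟨by rw [Matrix.conjTranspose_smul, hz, star_trivial, smul_neg], ?_⟩
    rcases hz' with h | h
    · left
      rw [Matrix.trace_smul, h, smul_zero]
    · exact Or.inr h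

theorem conj_mem_skewSpace {τ : Prop} (U : Matrix.unitaryGroup (Fin n) ℂ)
    {z : Matrix (Fin n) (Fin n) ℂ} (hz : z ∈ skewSpace n τ) :
    (U : Matrix (Fin n) (Fin n) ℂ) * z * (U : Matrix (Fin n) (Fin n) ℂ)ᴴ ∈ skewSpace n τ := by
  obtain ⟨h1, h2⟩ := hz
  refine ⟨?_, ?_⟩
  · simp [Matrix.conjTranspose_mul, h1, Matrix.mul_assoc]
  · rw [Matrix.trace_mul_comm, ← Matrix.mul_assoc, unitary_conjTranspose_mul, Matrix.one_mul]
    exact h2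

/-- If `E` is not square, the trace of the skew-Hermitian part is controlled by its traceless
part. -/
theorem frob_skewPart_le (hE : Eᴴ * E = 1) (hd : d < n) (X : Matrix (Fin n) (Fin n) ℂ) (α : ℂ) :
    frob (skewPart E X) ≤ (2 + 2 * (n : ℝ) ^ 2) * frob (skewPart E X - α • 1) := by
  set P := E * Eᴴ with hP
  set R := 1 - P with hR
  set M₀ := skewPart E X - α • 1 with hM₀
  have hPP : P * P = P := by
    rw [hP, Matrix.mul_assoc, ← Matrix.mul_assoc Eᴴ, hE, Matrix.one_mul]
  have hPR : P * R = 0 := by rw [hR, mul_sub, mul_one, hPP, sub_self]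
  have hRP : R * P = 0 := by rw [hR, sub_mul, one_mul, hPP, sub_self]
  have hRR : R * R = R := by
    conv_lhs => rw [hR, sub_mul, one_mul, hPR, sub_zero]
  have hRh : Rᴴ = R := by
    simp [hR, hP, Matrix.conjTranspose_mul]
  have hfR : frob R = n - d := by
    rw [frob_eq_trace, hRh, hRR, hR, Matrix.trace_sub, Matrix.trace_one, hP,
      Matrix.trace_mul_comm, hE, Matrix.trace_one]
    simp
  -- The skew part vanishes in the corner cut out by `R = 1 - E E†`, so that corner of `M₀` shows
  -- only the scalar `α`. It is a nonzero corner because `d < n`.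
  have hRMR : R * M₀ * R = -(α • R) := by
    rw [hM₀, skewPart, ← hP]
    simp only [mul_sub, sub_mul, Matrix.mul_assoc, hPR, Matrix.mul_zero]
    rw [← Matrix.mul_assoc R P, hRP]
    simp [hRR]
  have hα : ‖α‖ ^ 2 * (n - d : ℝ) ≤ (n - d : ℝ) * frob M₀ * (n - d : ℝ) := by
    have h1 := (frob_mul_le (R * M₀) R).trans
      (mul_le_mul_of_nonneg_right (frob_mul_le R M₀) (frob_nonneg R))
    rw [hRMR, ← neg_smul, frob_smul, norm_neg, hfR] at h1
    exact h1
  have hnd : (0 : ℝ) < n - d := sub_pos.2 (by exact_mod_cast hd)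
  have hα' : ‖α‖ ^ 2 ≤ n * frob M₀ := by
    have h1 : ‖α‖ ^ 2 ≤ (n - d : ℝ) * frob M₀ := le_of_mul_le_mul_right hα hnd
    refine h1.trans (mul_le_mul_of_nonneg_right ?_ (frob_nonneg _))
    simp
  have h1 : frob (1 : Matrix (Fin n) (Fin n) ℂ) = n := by
    rw [frob_eq_trace]
    simp
  -- The corner gives `‖α‖² ≤ n * frob M₀` and `1` has squared norm `n`, whence the constant `2 + 2
  -- n²`.
  have h2 := frob_add_le M₀ (α • 1)
  rw [frob_smul, h1, hM₀, sub_add_cancel, ← hM₀] at h2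
  have h3 : ‖α‖ ^ 2 * n ≤ n * frob M₀ * n := mul_le_mul_of_nonneg_right hα' (Nat.cast_nonneg n)
  nlinarith

/-- The output functional is represented by half the skew part of `X E E†`. When only traceless test
matrices are available its trace must be subtracted, and `d < n` limits the loss. The factor `1 / 4`
is the square of that half, and `2 - c² / 2` comes from `V ≤ c²`. -/
theorem exists_skew_representative (hE : Eᴴ * E = 1) {τ : Prop} (hτ : d < n ∨ τ) {c : ℝ}
    (hc0 : 0 < c) (hc : c < 2) :
    ∃ C : ℝ, 0 < C ∧ ∀ X : Matrix.unitaryGroup (Fin n) ℂ, X ∈ partialBall E 1 c →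
      ∃ N ∈ skewSpace n τ, C * lyapunov E (X : Matrix (Fin n) (Fin n) ℂ) ≤ frob N ∧
        ∀ y ∈ skewSpace n τ, traceForm N y = (trace (Eᴴ * y * (X : Matrix (Fin n) (Fin n) ℂ) * E)).re := by
  have hpos : 0 < 2 - c ^ 2 / 2 := by nlinarith
  have hden : (0 : ℝ) < 2 + 2 * (n : ℝ) ^ 2 := by positivity
  refine ⟨1 / 4 * ((2 - c ^ 2 / 2) / (2 + 2 * (n : ℝ) ^ 2)), by positivity, fun X hX => ?_⟩
  set M := skewPart E (X : Matrix (Fin n) (Fin n) ℂ) with hM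
  have hV0 := lyapunov_nonneg hE X
  have hV := lyapunov_le_of_mem_partialBall hE hX
  have hlow : (2 - c ^ 2 / 2) * lyapunov E (X : Matrix (Fin n) (Fin n) ℂ) ≤ frob M := by
    have := lyapunov_le_frob_skewPart hE (unitary_conjTranspose_mul X)
    nlinarith
  have hMh : Mᴴ = -M := skewPart_conjTranspose _
  by_cases h : τ
  · refine ⟨(1 / 2 : ℝ) • M, Submodule.smul_mem _ _ ⟨hMh, Or.inr h⟩, ?_, ?_⟩
    · rw [frob_real_smul]
      have h1 : (2 - c ^ 2 / 2) / (2 + 2 * (n : ℝ) ^ 2) ≤ 2 - c ^ 2 / 2 :=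
        div_le_self hpos.le (by nlinarith [sq_nonneg (n : ℝ)])
      have h2 := mul_le_mul_of_nonneg_right h1 hV0
      linarith
    · intro y hy
      have := traceForm_skewPart (E := E) (X : Matrix (Fin n) (Fin n) ℂ) y hy.1
      rw [traceForm_apply] at this ⊢
      rw [Matrix.smul_mul, Matrix.trace_smul, Complex.real_smul, Complex.re_ofReal_mul, this]
      ring
  · have hd := hτ.resolve_right h
    have hn : (n : ℂ) ≠ 0 := by
      have : n ≠ 0 := by omega
      exact_mod_cast this
    set α := M.trace / n with hα
    have hαc : star α = -α := by
      rw [hα, star_div₀, star_natCast, ← Matrix.trace_conjTranspose, hMh, Matrix.trace_neg,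
        neg_div]
    refine ⟨(1 / 2 : ℝ) • (M - α • 1), Submodule.smul_mem _ _ ⟨?_, Or.inl ?_⟩, ?_, ?_⟩
    · rw [Matrix.conjTranspose_sub, Matrix.conjTranspose_smul, hMh, hαc, Matrix.conjTranspose_one,
        neg_smul]
      abel
    · rw [Matrix.trace_sub, Matrix.trace_smul, Matrix.trace_one, Fintype.card_fin, smul_eq_mul,
        hα, div_mul_cancel₀ _ hn, sub_self]
    · rw [frob_real_smul]
      have h1 := hlow.trans (frob_skewPart_le hE hd (X : Matrix (Fin n) (Fin n) ℂ) α)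
      have h2 : (2 - c ^ 2 / 2) / (2 + 2 * (n : ℝ) ^ 2) *
          lyapunov E (X : Matrix (Fin n) (Fin n) ℂ) ≤ frob (M - α • 1) := by
        rw [div_mul_eq_mul_div, div_le_iff₀ hden]
        linarith
      linarith
    · intro y hy
      have h1 := traceForm_skewPart (E := E) (X : Matrix (Fin n) (Fin n) ℂ) y hy.1
      rw [traceForm_apply] at h1 ⊢
      rw [Matrix.smul_mul, Matrix.trace_smul, Complex.real_smul, Complex.re_ofReal_mul,
        Matrix.sub_mul, Matrix.smul_mul, Matrix.one_mul, Matrix.trace_sub, Matrix.trace_smul,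
        hy.2.resolve_right h, smul_zero, sub_zero, h1]
      ring

end Lyapunov

/-! ### The observability Gramian -/

section Gramian

variable {n m : ℕ}

theorem continuousOn_of_hasDerivWithinAt_matrix {X X' : ℝ → Matrix (Fin n) (Fin n) ℂ} {s : Set ℝ}
    (h : ∀ t ∈ s, HasDerivWithinAt X (X' t) s t) : ContinuousOn X s := by
  let _ : NormedAddCommGroup (Matrix (Fin n) (Fin n) ℂ) := Matrix.normedAddCommGroup
  let _ : NormedSpace ℝ (Matrix (Fin n) (Fin n) ℂ) := Matrix.normedSpace
  exact fun t ht => HasDerivWithinAt.continuousWithinAt (h t ht)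

theorem hasDerivWithinAt_Ici_of_Icc {X : ℝ → Matrix (Fin n) (Fin n) ℂ}
    {A : Matrix (Fin n) (Fin n) ℂ} {T t : ℝ} (ht : t ∈ Ico 0 T)
    (h : HasDerivWithinAt X A (Icc 0 T) t) : HasDerivWithinAt X A (Ici t) t := by
  let _ : NormedAddCommGroup (Matrix (Fin n) (Fin n) ℂ) := Matrix.normedAddCommGroup
  let _ : NormedSpace ℝ (Matrix (Fin n) (Fin n) ℂ) := Matrix.normedSpace
  exact HasDerivWithinAt.mono_of_mem_nhdsWithin h (Icc_mem_nhdsGE_of_mem ht)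

theorem continuous_frob {a b : ℕ} : Continuous (frob : Matrix (Fin a) (Fin b) ℂ → ℝ) := by
  unfold frob
  fun_prop

theorem continuous_traceForm {α : Type*} [TopologicalSpace α]
    {f g : α → Matrix (Fin n) (Fin n) ℂ} (hf : Continuous f) (hg : Continuous g) :
    Continuous fun a => traceForm (f a) (g a) := by
  simp only [traceForm_apply]
  exact Complex.continuous_re.comp (hf.matrix_mul hg).matrix_trace

theorem continuousOn_traceForm {g : ℝ → Matrix (Fin n) (Fin n) ℂ} {s : Set ℝ}
    (N : Matrix (Fin n) (Fin n) ℂ) (hg : ContinuousOn g s) :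
    ContinuousOn (fun a => traceForm N (g a)) s :=
  (continuous_traceForm (continuous_const (y := N)) continuous_id).comp_continuousOn hg

theorem isCompact_frob_sphere (L : Submodule ℝ (Matrix (Fin n) (Fin n) ℂ)) :
    IsCompact {N : Matrix (Fin n) (Fin n) ℂ | N ∈ L ∧ frob N = 1} := by
  let _ : NormedAddCommGroup (Matrix (Fin n) (Fin n) ℂ) := Matrix.normedAddCommGroup
  let _ : NormedSpace ℝ (Matrix (Fin n) (Fin n) ℂ) := Matrix.normedSpace
  have : ProperSpace (Matrix (Fin n) (Fin n) ℂ) := FiniteDimensional.proper ℝ _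
  refine Metric.isCompact_of_isClosed_isBounded ?_ ?_
  · exact (Submodule.closed_of_finiteDimensional L).inter
      (isClosed_singleton.preimage continuous_frob)
  · refine (Metric.isBounded_closedBall (x := 0) (r := 1)).subset ?_
    rintro N ⟨-, hN⟩
    rw [mem_closedBall_zero_iff, Matrix.norm_le_iff zero_le_one]
    intro i j
    have h := norm_sq_le_frob N i j
    rw [hN] at h
    exact (sq_le_one_iff₀ (norm_nonneg _)).1 h

/-- The observability Gramian of the `X† S_k X` along a curve `X`. -/
def gramian (H : Fin m → Matrix (Fin n) (Fin n) ℂ) (T : ℝ)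
    (X : ℝ → Matrix.unitaryGroup (Fin n) ℂ) (N : Matrix (Fin n) (Fin n) ℂ) : ℝ :=
  ∫ t in (0 : ℝ)..T, ∑ k, traceForm N (skewTilde (H k) (X t)) ^ 2

theorem continuousOn_skewTilde {s : Set ℝ} {X : ℝ → Matrix.unitaryGroup (Fin n) ℂ}
    (hX : ContinuousOn (fun t => (X t : Matrix (Fin n) (Fin n) ℂ)) s)
    (H : Matrix (Fin n) (Fin n) ℂ) : ContinuousOn (fun t => skewTilde H (X t)) s :=
  ((continuous_id.matrix_conjTranspose.comp_continuousOn hX).mul continuousOn_const).mul hX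

theorem continuousOn_traceForm_skewTilde {s : Set ℝ} {X : ℝ → Matrix.unitaryGroup (Fin n) ℂ}
    (hX : ContinuousOn (fun t => (X t : Matrix (Fin n) (Fin n) ℂ)) s)
    (H N : Matrix (Fin n) (Fin n) ℂ) :
    ContinuousOn (fun t => traceForm N (skewTilde H (X t))) s :=
  continuousOn_traceForm N (continuousOn_skewTilde hX H)

theorem continuous_gramian (H : Fin m → Matrix (Fin n) (Fin n) ℂ) {T : ℝ} (hT : 0 < T)
    {X : ℝ → Matrix.unitaryGroup (Fin n) ℂ}
    (hX : ContinuousOn (fun t => (X t : Matrix (Fin n) (Fin n) ℂ)) (Icc 0 T)) :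
    Continuous (gramian H T X) := by
  -- Clamping time to `[0, T]` gives globally continuous curves without changing the integral, as
  -- continuity of a parametric integral requires.
  let σ : Fin m → ℝ → Matrix (Fin n) (Fin n) ℂ := fun k t =>
    skewTilde (H k) (X (projIcc 0 T hT.le t))
  have hσ : ∀ k, Continuous (σ k) := fun k =>
    (continuousOn_iff_continuous_domRestrict.1 (continuousOn_skewTilde hX (H k))).comp
      continuous_projIcc
  have heq : gramian H T X =
      fun N => ∫ t in (0 : ℝ)..T, ∑ k, traceForm N (σ k t) ^ 2 := by
    ext1 N
    refine intervalIntegral.integral_congr fun t ht => ?_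
    rw [uIcc_of_le hT.le] at ht
    simp only [σ, projIcc_of_mem hT.le ht]
  rw [heq]
  refine intervalIntegral.continuous_parametric_intervalIntegral_of_continuous' ?_ 0 T
  refine continuous_finsetSum _ fun k _ => Continuous.pow ?_ 2
  exact continuous_traceForm continuous_fst ((hσ k).comp continuous_snd)

theorem gramian_smul (H : Fin m → Matrix (Fin n) (Fin n) ℂ) (T : ℝ)
    (X : ℝ → Matrix.unitaryGroup (Fin n) ℂ) (r : ℝ) (N : Matrix (Fin n) (Fin n) ℂ) :
    gramian H T X (r • N) = r ^ 2 * gramian H T X N := by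
  rw [gramian, gramian, ← intervalIntegral.integral_const_mul]
  congr 1
  ext1 t
  rw [Finset.mul_sum]
  refine Finset.sum_congr rfl fun k _ => ?_
  rw [traceForm_apply, traceForm_apply, Matrix.smul_mul, Matrix.trace_smul, Complex.real_smul,
    Complex.re_ofReal_mul, mul_pow]

/-- An injective Gramian is bounded below. -/
theorem exists_gramian_lower_bound (H : Fin m → Matrix (Fin n) (Fin n) ℂ) {T : ℝ} (hT : 0 < T)
    {X : ℝ → Matrix.unitaryGroup (Fin n) ℂ}
    (hX : ContinuousOn (fun t => (X t : Matrix (Fin n) (Fin n) ℂ)) (Icc 0 T))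
    (L : Submodule ℝ (Matrix (Fin n) (Fin n) ℂ))
    (hinj : ∀ N ∈ L, (∀ k, ∀ t ∈ Icc 0 T, traceForm N (skewTilde (H k) (X t)) = 0) → N = 0) :
    ∃ g : ℝ, 0 < g ∧ ∀ N ∈ L, g * frob N ≤ gramian H T X N := by
  have hpos : ∀ N ∈ L, N ≠ 0 → 0 < gramian H T X N := by
    intro N hN hN0
    have hex : ∃ k, ∃ t ∈ Icc 0 T, traceForm N (skewTilde (H k) (X t)) ≠ 0 := by
      by_contra! hcon
      exact hN0 (hinj N hN hcon)
    obtain ⟨k, t, ht, hne⟩ := hex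
    have h := intervalIntegral.integral_lt_integral_of_continuousOn_of_le_of_exists_lt
      (f := fun _ => 0) (g := fun t => ∑ k, traceForm N (skewTilde (H k) (X t)) ^ 2) hT
      continuousOn_const
      (continuousOn_finsetSum _ fun k _ => (continuousOn_traceForm_skewTilde hX (H k) N).pow 2)
      (fun t _ => Finset.sum_nonneg fun k _ => sq_nonneg _)
      ⟨t, ht, Finset.sum_pos' (fun k _ => sq_nonneg _)
        ⟨k, Finset.mem_univ k, by positivity⟩⟩
    rw [intervalIntegral.integral_zero] at h
    exact h
  have hne : ∀ {N : Matrix (Fin n) (Fin n) ℂ}, N ≠ 0 → 0 < frob N := fun {N} hN =>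
    lt_of_le_of_ne (frob_nonneg N) fun h => hN (frob_eq_zero h.symm)
  by_cases hL : {N : Matrix (Fin n) (Fin n) ℂ | N ∈ L ∧ frob N = 1}.Nonempty
  · obtain ⟨N₁, ⟨hN₁L, hN₁⟩, hmin⟩ := (isCompact_frob_sphere L).exists_isMinOn hL
      (continuous_gramian H hT hX).continuousOn
    refine ⟨gramian H T X N₁, hpos N₁ hN₁L ?_, fun N hN => ?_⟩
    · rintro rfl
      simp [frob] at hN₁
    · by_cases hN0 : N = 0
      · have h0 := gramian_smul H T X 0 N
        rw [zero_smul] at h0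
        rw [hN0, h0]
        simp [frob]
      · have hf := hne hN0
        set r := (Real.sqrt (frob N))⁻¹ with hr
        have hr2 : r ^ 2 = (frob N)⁻¹ := by rw [hr, inv_pow, Real.sq_sqrt hf.le]
        have h1 : frob (r • N) = 1 := by
          rw [frob_real_smul, hr2, inv_mul_cancel₀ hf.ne']
        have h2 : gramian H T X N₁ ≤ gramian H T X (r • N) := hmin ⟨L.smul_mem r hN, h1⟩
        rw [gramian_smul, hr2, inv_mul_eq_div, le_div_iff₀ hf] at h2
        exact h2
  -- An empty unit sphere forces `L` to be zero, and any positive constant works.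
  · refine ⟨1, one_pos, fun N hN => ?_⟩
    have hN0 : N = 0 := by
      by_contra hN0
      have hf := hne hN0
      refine hL ⟨(Real.sqrt (frob N))⁻¹ • N, L.smul_mem _ hN, ?_⟩
      rw [frob_real_smul, inv_pow, Real.sq_sqrt hf.le, inv_mul_cancel₀ hf.ne']
    have h0 := gramian_smul H T X 0 N
    rw [zero_smul] at h0
    rw [hN0, h0]
    simp [frob]

/-- Two reference trajectories with the same inputs differ by a constant unitary matrix. -/
theorem referenceTrajectory_eq_mul {H₀ : Matrix (Fin n) (Fin n) ℂ}
    {H : Fin m → Matrix (Fin n) (Fin n) ℂ} (hH₀ : H₀.IsHermitian) (hH : ∀ k, (H k).IsHermitian)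
    {T : ℝ} {u : Fin m → ℝ → ℝ} {X₀ Y₀ : Matrix.unitaryGroup (Fin n) ℂ}
    {X Y : ℝ → Matrix.unitaryGroup (Fin n) ℂ} (hX : IsReferenceTrajectory H₀ H T u X₀ X)
    (hY : IsReferenceTrajectory H₀ H T u Y₀ Y) :
    ∀ t ∈ Icc 0 T, Y t = X t * (X₀⁻¹ * Y₀) := by
  have hXc := continuousOn_of_hasDerivWithinAt_matrix hX.2
  have hYc := continuousOn_of_hasDerivWithinAt_matrix hY.2
  have hd : ∀ t ∈ Icc 0 T, HasDerivWithinAt (fun t => (X t : Matrix (Fin n) (Fin n) ℂ)ᴴ *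
      (Y t : Matrix (Fin n) (Fin n) ℂ)) 0 (Icc 0 T) t := by
    intro t ht
    have h := hasDerivWithinAt_matrix_mul (hasDerivWithinAt_conjTranspose (hX.2 t ht)) (hY.2 t ht)
    rw [Matrix.conjTranspose_mul, generator_conjTranspose hH₀ hH] at h
    simpa [Matrix.mul_assoc] using h
  have hconst : ∀ t ∈ Icc 0 T, (X t : Matrix (Fin n) (Fin n) ℂ)ᴴ *
      (Y t : Matrix (Fin n) (Fin n) ℂ) = (X 0 : Matrix (Fin n) (Fin n) ℂ)ᴴ *
        (Y 0 : Matrix (Fin n) (Fin n) ℂ) := by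
    have hc := continuousOn_of_hasDerivWithinAt_matrix hd
    have hr := fun t (ht : t ∈ Ico 0 T) => hasDerivWithinAt_Ici_of_Icc ht (hd t ⟨ht.1, ht.2.le⟩)
    let _ : NormedAddCommGroup (Matrix (Fin n) (Fin n) ℂ) := Matrix.normedAddCommGroup
    let _ : NormedSpace ℝ (Matrix (Fin n) (Fin n) ℂ) := Matrix.normedSpace
    exact constant_of_has_deriv_right_zero hc hr
  intro t ht
  have h : (X t)⁻¹ * Y t = X₀⁻¹ * Y₀ := by
    apply Subtype.ext
    rw [← hX.1, ← hY.1]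
    exact hconst t ht
  rw [← h, mul_inv_cancel_left]

theorem traceForm_skewTilde_mul (H N : Matrix (Fin n) (Fin n) ℂ)
    (X C : Matrix.unitaryGroup (Fin n) ℂ) :
    traceForm N (skewTilde H (X * C)) =
      traceForm ((C : Matrix (Fin n) (Fin n) ℂ) * N * (C : Matrix (Fin n) (Fin n) ℂ)ᴴ)
        (skewTilde H X) := by
  have h : skewTilde H (X * C) = (C : Matrix (Fin n) (Fin n) ℂ)ᴴ * skewTilde H X *
      (C : Matrix (Fin n) (Fin n) ℂ) := by
    simp only [skewTilde, Submonoid.coe_mul, Matrix.conjTranspose_mul, Matrix.mul_assoc]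
  rw [traceForm_apply, traceForm_apply, h, ← Matrix.mul_assoc, Matrix.trace_mul_comm]
  simp only [Matrix.mul_assoc]

/-- The Gramian is bounded below uniformly in the initial condition of the reference
trajectory. -/
theorem exists_uniform_gramian_lower_bound {H₀ : Matrix (Fin n) (Fin n) ℂ}
    {H : Fin m → Matrix (Fin n) (Fin n) ℂ} (hH₀ : H₀.IsHermitian) (hH : ∀ k, (H k).IsHermitian)
    {T : ℝ} (hT : 0 < T) {u : Fin m → ℝ → ℝ} (τ : Prop)
    (hobs : ∀ (X₀ : Matrix.unitaryGroup (Fin n) ℂ) (X : ℝ → Matrix.unitaryGroup (Fin n) ℂ),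
      IsReferenceTrajectory H₀ H T u X₀ X → ∀ N : Matrix (Fin n) (Fin n) ℂ,
        (∀ k, ∀ t ∈ Icc 0 T, traceForm N (skewTilde (H k) (X t)) = 0) →
          N ∈ skewSpace n τ → N = 0) :
    ∃ g : ℝ, 0 < g ∧ ∀ (X₀ : Matrix.unitaryGroup (Fin n) ℂ)
      (X : ℝ → Matrix.unitaryGroup (Fin n) ℂ), IsReferenceTrajectory H₀ H T u X₀ X →
        ∀ N ∈ skewSpace n τ, g * frob N ≤ gramian H T X N := by
  by_cases hex : ∃ (X₀ : Matrix.unitaryGroup (Fin n) ℂ) (X : ℝ → Matrix.unitaryGroup (Fin n) ℂ),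
      IsReferenceTrajectory H₀ H T u X₀ X
  · obtain ⟨X₀, X, hX⟩ := hex
    obtain ⟨g, hg, hbound⟩ := exists_gramian_lower_bound H hT
      (continuousOn_of_hasDerivWithinAt_matrix hX.2) (skewSpace n τ)
      (fun N hN h => hobs X₀ X hX N h hN)
    refine ⟨g, hg, fun Y₀ Y hY N hN => ?_⟩
    have hYX := referenceTrajectory_eq_mul hH₀ hH hX hY
    set C := X₀⁻¹ * Y₀
    -- The right factor `C` can be moved onto `N` by conjugation, which preserves both the space and
    -- the Frobenius norm; one trajectory therefore fixes the constant for all.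
    have h := hbound _ (conj_mem_skewSpace C hN)
    rw [frob_conj] at h
    refine h.trans (le_of_eq (intervalIntegral.integral_congr fun t ht => ?_))
    rw [uIcc_of_le hT.le] at ht
    simp only [hYX t ht, traceForm_skewTilde_mul]
  · push Not at hex
    exact ⟨1, one_pos, fun X₀ X hX => absurd hX (hex X₀ X)⟩

end Gramian

/-! ### The decrease of the Lyapunov function -/

section Decrease

/-- If the output energy is small, then the state moves little, so that the output of the frozen
initial state has small energy too. -/
theorem frozen_energy_le {F : Type*} [NormedAddCommGroup F] [NormedSpace ℝ F] {m : ℕ}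
    {T K a : ℝ} (hT : 0 < T) (hK : 0 < K) (ha : 0 ≤ a) {V : ℝ → ℝ} {y z : Fin m → ℝ → ℝ}
    {X X' : ℝ → F}
    (hV : ∀ t ∈ Icc 0 T, HasDerivWithinAt V (-(4 * K * ∑ k, y k t ^ 2)) (Icc 0 T) t)
    (hy : ∀ k, ContinuousOn (y k) (Icc 0 T)) (hz : ∀ k, ContinuousOn (z k) (Icc 0 T))
    (hX : ∀ t ∈ Icc 0 T, HasDerivWithinAt X (X' t) (Icc 0 T) t)
    (hX' : ∀ t ∈ Icc 0 T, ‖X' t‖ ≤ a * ∑ k, |y k t|)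
    (hyz : ∀ k, ∀ t ∈ Icc 0 T, |z k t - y k t| ≤ a * ‖X t - X 0‖) :
    ∫ t in (0 : ℝ)..T, ∑ k, z k t ^ 2 ≤
      (1 / (2 * K) + 2 * m * T * a ^ 2 * (a * (m * T + 1 / (16 * K))) ^ 2) * (V 0 - V T) := by
  set b := a * (m * T + 1 / (16 * K)) with hb
  have hb0 : 0 ≤ b := by positivity
  have hVc : ContinuousOn V (Icc 0 T) := fun t ht => (hV t ht).continuousWithinAt
  have hVint : ∀ t ∈ Ioo 0 T, HasDerivAt V (-(4 * K * ∑ k, y k t ^ 2)) t := fun t ht =>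
    (hV t ⟨ht.1.le, ht.2.le⟩).hasDerivAt (Icc_mem_nhds ht.1 ht.2)
  have hsq : ∀ t, 0 ≤ ∑ k, y k t ^ 2 := fun t => Finset.sum_nonneg fun k _ => sq_nonneg _
  have hanti : AntitoneOn V (Icc 0 T) := by
    refine antitoneOn_of_deriv_nonpos (convex_Icc 0 T) hVc ?_ ?_
    · rw [interior_Icc]
      exact fun t ht => (hVint t ht).differentiableAt.differentiableWithinAt
    · rw [interior_Icc]
      intro t ht
      rw [(hVint t ht).deriv]
      have := hsq t
      have : 0 ≤ 4 * K * ∑ k, y k t ^ 2 := by positivity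
      linarith
  have hyc : ContinuousOn (fun t => ∑ k, y k t ^ 2) (Icc 0 T) :=
    continuousOn_finsetSum _ fun k _ => (hy k).pow 2
  have hint : ∫ t in (0 : ℝ)..T, ∑ k, y k t ^ 2 = (V 0 - V T) / (4 * K) := by
    have h := intervalIntegral.integral_eq_sub_of_hasDerivAt_of_le hT.le hVc hVint
      ((continuousOn_const.mul hyc).neg.intervalIntegrable_of_Icc hT.le)
    rw [intervalIntegral.integral_neg, intervalIntegral.integral_const_mul] at h
    rw [eq_div_iff (by positivity)]
    linarith
  set Φ := V 0 - V T with hΦ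
  have hΦt : ∀ t ∈ Icc 0 T, V 0 - V t ≤ Φ := fun t ht => by
    have := hanti ht ⟨hT.le, le_rfl⟩ ht.2
    linarith
  have hΦ0 : 0 ≤ Φ := by
    have := hΦt 0 ⟨le_rfl, hT.le⟩
    linarith
  -- A pointwise Young inequality `|y| ≤ ε + y² / (4 ε)` replaces Cauchy–Schwarz in time. Since `∑
  -- yₖ² = -V' / (4 K)`, the integrated bound is explicit in `V` and serves as a barrier for `‖X t -
  -- X 0‖`.
  have hmove : ∀ ε : ℝ, 0 < ε → Φ ≤ ε ^ 2 → ∀ t ∈ Icc 0 T, ‖X t - X 0‖ ≤ b * ε := by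
    intro ε hε hΦε t ht
    have h := image_norm_le_of_norm_deriv_right_le_deriv_boundary'
      (f := fun t => X t - X 0) (f' := X') (a := 0) (b := T)
      (B := fun t => a * (m * ε * t + (V 0 - V t) / (16 * K * ε)))
      (B' := fun t => a * (m * ε * 1 + (-(-(4 * K * ∑ k, y k t ^ 2))) / (16 * K * ε)))
      (fun t ht => ((hX t ht).sub_const _).continuousWithinAt)
      (fun t ht => ((hX t ⟨ht.1, ht.2.le⟩).sub_const _).mono_of_mem_nhdsWithin
        (Icc_mem_nhdsGE_of_mem ht))
      (by simp)
      (by fun_prop)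
      (fun t ht => ((((hasDerivWithinAt_id t _).const_mul _).add
        ((((hV t ⟨ht.1, ht.2.le⟩).const_sub _).mono_of_mem_nhdsWithin
          (Icc_mem_nhdsGE_of_mem ht)).div_const _)).const_mul a))
      ?_ ht
    · refine h.trans ?_
      have hd : (V 0 - V t) / (16 * K * ε) ≤ ε / (16 * K) := by
        rw [div_le_div_iff₀ (by positivity) (by positivity)]
        have := (hΦt t ht).trans hΦε
        nlinarith [mul_le_mul_of_nonneg_right this hK.le]
      have hm : (m : ℝ) * ε * t ≤ m * ε * T :=
        mul_le_mul_of_nonneg_left ht.2 (by positivity)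
      calc a * (m * ε * t + (V 0 - V t) / (16 * K * ε))
          ≤ a * (m * ε * T + ε / (16 * K)) := by gcongr
        _ = b * ε := by rw [hb]; ring
    · intro t ht
      refine (hX' t ⟨ht.1, ht.2.le⟩).trans (mul_le_mul_of_nonneg_left ?_ ha)
      have hk : ∀ k, |y k t| ≤ ε + y k t ^ 2 / (4 * ε) := by
        intro k
        have h1 : 0 ≤ (2 * ε - |y k t|) ^ 2 := sq_nonneg _
        have h2 := sq_abs (y k t)
        have : |y k t| - ε ≤ y k t ^ 2 / (4 * ε) := by
          rw [le_div_iff₀ (by positivity)]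
          nlinarith
        linarith
      refine (Finset.sum_le_sum fun k _ => hk k).trans (le_of_eq ?_)
      rw [Finset.sum_add_distrib, ← Finset.sum_div]
      simp only [Finset.sum_const, Finset.card_univ, Fintype.card_fin, nsmul_eq_mul]
      field_simp
      ring
  have hmove' : ∀ t ∈ Icc 0 T, ‖X t - X 0‖ ≤ b * Real.sqrt Φ := by
    intro t ht
    refine le_of_forall_pos_le_add fun e he => ?_
    have hs := Real.sqrt_nonneg Φ
    -- The optimal choice `ε = √Φ` may be zero, so it is enlarged; `b / (b + 1) ≤ 1` keeps the error
    -- below `e`.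
    have h1 := hmove (Real.sqrt Φ + e / (b + 1)) (by positivity) (by
      have := Real.sq_sqrt hΦ0
      have h0 : 0 ≤ e / (b + 1) := by positivity
      nlinarith) t ht
    have h2 : b * (e / (b + 1)) ≤ e := by
      rw [← mul_div_assoc, div_le_iff₀ (by positivity)]
      nlinarith
    linarith
  have hpt : ∀ t ∈ Icc 0 T, ∑ k, z k t ^ 2 ≤
      2 * ∑ k, y k t ^ 2 + 2 * m * a ^ 2 * b ^ 2 * Φ := by
    intro t ht
    have hk : ∀ k, z k t ^ 2 ≤ 2 * y k t ^ 2 + 2 * a ^ 2 * b ^ 2 * Φ := by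
      intro k
      have h1 : |z k t - y k t| ≤ a * (b * Real.sqrt Φ) :=
        (hyz k t ht).trans (mul_le_mul_of_nonneg_left (hmove' t ht) ha)
      have h2 := pow_le_pow_left₀ (abs_nonneg _) h1 2
      rw [sq_abs, mul_pow, mul_pow, Real.sq_sqrt hΦ0] at h2
      nlinarith [sq_nonneg (z k t - 2 * y k t)]
    refine (Finset.sum_le_sum fun k _ => hk k).trans (le_of_eq ?_)
    rw [Finset.sum_add_distrib, ← Finset.mul_sum]
    simp only [Finset.sum_const, Finset.card_univ, Fintype.card_fin, nsmul_eq_mul]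
    ring
  have hzc : ContinuousOn (fun t => ∑ k, z k t ^ 2) (Icc 0 T) :=
    continuousOn_finsetSum _ fun k _ => (hz k).pow 2
  calc ∫ t in (0 : ℝ)..T, ∑ k, z k t ^ 2
      ≤ ∫ t in (0 : ℝ)..T, (2 * ∑ k, y k t ^ 2 + 2 * m * a ^ 2 * b ^ 2 * Φ) :=
        intervalIntegral.integral_mono_on hT.le (hzc.intervalIntegrable_of_Icc hT.le)
          (((continuousOn_const.mul hyc).add continuousOn_const).intervalIntegrable_of_Icc hT.le)
          hpt
    _ = (1 / (2 * K) + 2 * m * T * a ^ 2 * b ^ 2) * Φ := by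
        have hi : IntervalIntegrable (fun t => 2 * ∑ k, y k t ^ 2) volume 0 T :=
          (continuousOn_const.mul hyc).intervalIntegrable_of_Icc hT.le
        rw [intervalIntegral.integral_add hi intervalIntegrable_const,
          intervalIntegral.integral_const_mul, hint, intervalIntegral.integral_const, smul_eq_mul]
        field_simp
        ring

variable {n m d : ℕ}

theorem norm_unitary_sandwich_le (U V : Matrix.unitaryGroup (Fin n) ℂ)
    (S : Matrix (Fin n) (Fin n) ℂ) (i j : Fin n) :
    ‖((U : Matrix (Fin n) (Fin n) ℂ)ᴴ * S * (V : Matrix (Fin n) (Fin n) ℂ)) i j‖ ≤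
      ∑ p, ∑ q, ‖S p q‖ := by
  rw [Matrix.mul_apply]
  refine (norm_sum_le _ _).trans ?_
  rw [Finset.sum_comm]
  refine Finset.sum_le_sum fun q _ => ?_
  rw [norm_mul, Matrix.mul_apply]
  refine (mul_le_of_le_one_right (norm_nonneg _) (entry_norm_bound_of_unitary V.2 q j)).trans ?_
  refine (norm_sum_le _ _).trans (Finset.sum_le_sum fun p _ => ?_)
  rw [norm_mul, Matrix.conjTranspose_apply, norm_star]
  exact mul_le_of_le_one_left (norm_nonneg _) (entry_norm_bound_of_unitary U.2 p i)

theorem abs_traceForm_le (P W : Matrix (Fin n) (Fin n) ℂ) {r : ℝ} (hW : ∀ i j, ‖W i j‖ ≤ r) :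
    |traceForm P W| ≤ (∑ i, ∑ j, ‖P i j‖) * r := by
  rw [traceForm_apply]
  refine (Complex.abs_re_le_norm _).trans ?_
  rw [Matrix.trace, Finset.sum_mul]
  refine (norm_sum_le _ _).trans (Finset.sum_le_sum fun i _ => ?_)
  rw [Matrix.diag_apply, Matrix.mul_apply, Finset.sum_mul]
  refine (norm_sum_le _ _).trans (Finset.sum_le_sum fun j _ => ?_)
  rw [norm_mul]
  exact mul_le_mul_of_nonneg_left (hW j i) (norm_nonneg _)

theorem re_trace_eq_traceForm (E : Matrix (Fin n) (Fin d) ℂ) (S Y : Matrix (Fin n) (Fin n) ℂ) :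
    (trace (Eᴴ * S * Y * E)).re = traceForm (E * Eᴴ) (S * Y) := by
  rw [traceForm_apply, Matrix.trace_mul_comm, ← Matrix.mul_assoc, ← Matrix.mul_assoc]
  simp only [Matrix.mul_assoc]

theorem lyapunov_eq_traceForm (E : Matrix (Fin n) (Fin d) ℂ) (X : Matrix (Fin n) (Fin n) ℂ) :
    lyapunov E X = 2 * (d : ℝ) - 2 * traceForm (E * Eᴴ) X := by
  rw [lyapunov, traceForm_apply, Matrix.mul_assoc, Matrix.trace_mul_comm, Matrix.mul_assoc,
    Matrix.trace_mul_comm]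

/-- The decrease of the Lyapunov function along the closed loop system dominates the output energy
of the frozen initial state. -/
theorem exists_decrease_bound (H : Fin m → Matrix (Fin n) (Fin n) ℂ)
    (E : Matrix (Fin n) (Fin d) ℂ) {K T : ℝ} (hK : 0 < K) (hT : 0 < T) :
    ∃ C : ℝ, 0 < C ∧ ∀ X : ℝ → Matrix.unitaryGroup (Fin n) ℂ,
      ContinuousOn (fun t => (X t : Matrix (Fin n) (Fin n) ℂ)) (Icc 0 T) →
      ∀ (Y₀ : Matrix.unitaryGroup (Fin n) ℂ) (Y : ℝ → Matrix.unitaryGroup (Fin n) ℂ),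
        IsClosedLoopTrajectory H E K T X Y₀ Y →
        ∫ t in (0 : ℝ)..T, ∑ k, (trace (Eᴴ * skewTilde (H k) (X t) *
          (Y 0 : Matrix (Fin n) (Fin n) ℂ) * E)).re ^ 2 ≤
            C * (lyapunov E (Y 0) - lyapunov E (Y T)) := by
  let _ : NormedAddCommGroup (Matrix (Fin n) (Fin n) ℂ) := Matrix.normedAddCommGroup
  let _ : NormedSpace ℝ (Matrix (Fin n) (Fin n) ℂ) := Matrix.normedSpace
  obtain ⟨s, hs⟩ : ∃ s : ℝ, s = ∑ k, ∑ p, ∑ q, ‖skew (H k) p q‖ := ⟨_, rfl⟩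
  have hs0 : 0 ≤ s := hs ▸ Finset.sum_nonneg fun _ _ => Finset.sum_nonneg fun _ _ =>
    Finset.sum_nonneg fun _ _ => norm_nonneg _
  have hsk : ∀ k, ∑ p, ∑ q, ‖skew (H k) p q‖ ≤ s := fun k => hs ▸
    Finset.single_le_sum (f := fun k => ∑ p, ∑ q, ‖skew (H k) p q‖)
      (fun _ _ => Finset.sum_nonneg fun _ _ => Finset.sum_nonneg fun _ _ => norm_nonneg _)
      (Finset.mem_univ k)
  obtain ⟨r, hr⟩ : ∃ r : ℝ, r = ∑ i, ∑ j, ‖(E * Eᴴ) i j‖ := ⟨_, rfl⟩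
  have hr0 : 0 ≤ r := hr ▸ Finset.sum_nonneg fun _ _ => Finset.sum_nonneg fun _ _ => norm_nonneg _
  -- One constant for two estimates: `2 K s` bounds the speed of the closed loop in terms of the
  -- outputs, and `r * (n * s)` is a Lipschitz constant of the outputs in the state.
  obtain ⟨a, ha⟩ : ∃ a : ℝ, a = 2 * K * s + r * (n * s) := ⟨_, rfl⟩
  have ha0 : 0 ≤ a := by
    rw [ha]
    positivity
  refine ⟨1 / (2 * K) + 2 * m * T * a ^ 2 * (a * (m * T + 1 / (16 * K))) ^ 2, by positivity,
    fun X hX Y₀ Y hY => ?_⟩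
  have hYc : ContinuousOn (fun t => (Y t : Matrix (Fin n) (Fin n) ℂ)) (Icc 0 T) :=
    continuousOn_of_hasDerivWithinAt_matrix hY.2
  have hSt : ∀ k t i j, ‖skewTilde (H k) (X t) i j‖ ≤ s := fun k t i j =>
    (norm_unitary_sandwich_le (X t) (X t) (skew (H k)) i j).trans (hsk k)
  simp only [re_trace_eq_traceForm]
  refine frozen_energy_le (F := Matrix (Fin n) (Fin n) ℂ)
    (V := fun t => lyapunov E (Y t : Matrix (Fin n) (Fin n) ℂ))
    (y := fun k t => traceForm (E * Eᴴ) (skewTilde (H k) (X t) * (Y t : Matrix (Fin n) (Fin n) ℂ)))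
    (X := fun t => (Y t : Matrix (Fin n) (Fin n) ℂ))
    (X' := fun t => (∑ k, feedback E K (skewTilde (H k) (X t)) (Y t) • skewTilde (H k) (X t)) *
      (Y t : Matrix (Fin n) (Fin n) ℂ)) hT hK ha0 ?_ ?_ ?_ hY.2 ?_ ?_
  · intro t ht
    simp only [lyapunov_eq_traceForm]
    have h := ((hasDerivWithinAt_linearMap (traceForm (E * Eᴴ)) (hY.2 t ht)).const_mul 2).const_sub
      (2 * (d : ℝ))
    refine h.congr_deriv ?_
    rw [Finset.sum_mul, map_sum, Finset.mul_sum, Finset.mul_sum, ← Finset.sum_neg_distrib,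
      ← Finset.sum_neg_distrib]
    refine Finset.sum_congr rfl fun k _ => ?_
    rw [Matrix.smul_mul, map_smul, feedback_eq, re_trace_eq_traceForm, smul_eq_mul]
    ring
  · exact fun k => continuousOn_traceForm _ ((continuousOn_skewTilde hX (H k)).mul hYc)
  · exact fun k => continuousOn_traceForm _
      ((continuousOn_skewTilde hX (H k)).mul continuousOn_const)
  · intro t ht
    have h1 : ∀ k, ‖skewTilde (H k) (X t) * (Y t : Matrix (Fin n) (Fin n) ℂ)‖ ≤ s := by
      intro k
      rw [Matrix.norm_le_iff hs0]
      intro i j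
      have h := norm_unitary_sandwich_le (X t) (X t * Y t) (skew (H k)) i j
      rw [Submonoid.coe_mul, ← Matrix.mul_assoc] at h
      exact h.trans (hsk k)
    rw [Finset.sum_mul]
    refine (norm_sum_le _ _).trans ?_
    rw [Finset.mul_sum]
    refine Finset.sum_le_sum fun k _ => ?_
    rw [Matrix.smul_mul, norm_smul, feedback_eq, re_trace_eq_traceForm, norm_mul, Real.norm_eq_abs,
      Real.norm_eq_abs, abs_of_pos (by positivity : 0 < 2 * K)]
    have h2 : 2 * K * s ≤ a := by
      rw [ha]
      have : 0 ≤ r * (n * s) := by positivity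
      linarith
    calc 2 * K * |traceForm (E * Eᴴ) (skewTilde (H k) (X t) * Y t)| *
          ‖skewTilde (H k) (X t) * (Y t : Matrix (Fin n) (Fin n) ℂ)‖
        ≤ 2 * K * |traceForm (E * Eᴴ) (skewTilde (H k) (X t) * Y t)| * s :=
          mul_le_mul_of_nonneg_left (h1 k) (by positivity)
      _ = 2 * K * s * |traceForm (E * Eᴴ) (skewTilde (H k) (X t) * Y t)| := by ring
      _ ≤ a * |traceForm (E * Eᴴ) (skewTilde (H k) (X t) * Y t)| :=
          mul_le_mul_of_nonneg_right h2 (abs_nonneg _)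
  · intro k t ht
    rw [← map_sub, ← mul_sub, norm_sub_rev]
    set D := (Y 0 : Matrix (Fin n) (Fin n) ℂ) - (Y t : Matrix (Fin n) (Fin n) ℂ)
    have h1 : ∀ i j, ‖(skewTilde (H k) (X t) * D) i j‖ ≤ n * s * ‖D‖ := by
      intro i j
      rw [Matrix.mul_apply]
      refine (norm_sum_le _ _).trans ?_
      have h2 : ∀ l, ‖skewTilde (H k) (X t) i l * D l j‖ ≤ s * ‖D‖ := fun l => by
        rw [norm_mul]
        exact mul_le_mul (hSt k t i l) (Matrix.norm_entry_le_entrywise_sup_norm D)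
          (norm_nonneg _) hs0
      refine (Finset.sum_le_sum fun l _ => h2 l).trans (le_of_eq ?_)
      simp only [Finset.sum_const, Finset.card_univ, Fintype.card_fin, nsmul_eq_mul]
      ring
    refine (abs_traceForm_le _ _ h1).trans ?_
    rw [← mul_assoc, ← hr]
    refine mul_le_mul_of_nonneg_right ?_ (norm_nonneg _)
    rw [ha]
    have : 0 ≤ 2 * K * s := by positivity
    linarith

/-- Observability of the linearized system implies uniform attractivity. -/
theorem uniformlyAttractive_of_observable {H₀ : Matrix (Fin n) (Fin n) ℂ}
    {H : Fin m → Matrix (Fin n) (Fin n) ℂ} (hH₀ : H₀.IsHermitian) (hH : ∀ k, (H k).IsHermitian)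
    {E : Matrix (Fin n) (Fin d) ℂ} (hE : Eᴴ * E = 1) (hd : d < n ∨ ∃ k, (H k).trace ≠ 0)
    {K c T : ℝ} (hK : 0 < K) (hc0 : 0 < c) (hc : c < 2) (hT : 0 < T) {u : Fin m → ℝ → ℝ}
    (hobs : ∀ (X₀ : Matrix.unitaryGroup (Fin n) ℂ) (X : ℝ → Matrix.unitaryGroup (Fin n) ℂ),
      IsReferenceTrajectory H₀ H T u X₀ X → ∀ N : Matrix (Fin n) (Fin n) ℂ,
        (∀ k, ∀ t ∈ Icc 0 T, traceForm N (skewTilde (H k) (X t)) = 0) →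
          N ∈ skewSpace n (∃ k, (H k).trace ≠ 0) → N = 0) :
    UniformlyAttractive H₀ H E K T c u := by
  obtain ⟨g, hg, hgram⟩ := exists_uniform_gramian_lower_bound hH₀ hH hT _ hobs
  obtain ⟨C₁, hC₁, hrep⟩ := exists_skew_representative hE hd hc0 hc
  obtain ⟨C₂, hC₂, hdec⟩ := exists_decrease_bound H E hK hT
  have hρ : 0 < g * C₁ / C₂ := by positivity
  -- The contraction factor is `1 - g * C₁ / C₂`; this number may fail to be positive, and the
  -- maximum with `1 / 2` keeps the factor in `(0, 1)`.
  refine ⟨max (1 - g * C₁ / C₂) (1 / 2), ⟨lt_max_of_lt_right (by norm_num),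
    max_lt (by linarith) (by norm_num)⟩, fun X₀ X hX Z₀ hZ Y hY => ?_⟩
  rw [← hY.1] at hZ
  obtain ⟨N, hN, hNlow, hNrep⟩ := hrep (Y 0) hZ
  have hV := lyapunov_nonneg hE (Y 0)
  have h1 := hgram X₀ X hX N hN
  have h2 := hdec X (continuousOn_of_hasDerivWithinAt_matrix hX.2) _ Y hY
  have hmem : ∀ k t, skewTilde (H k) (X t) ∈ skewSpace n (∃ k, (H k).trace ≠ 0) := by
    intro k t
    refine ⟨?_, ?_⟩
    · rw [skewTilde, Matrix.conjTranspose_mul, Matrix.conjTranspose_mul, skew_conjTranspose (hH k),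
        Matrix.conjTranspose_conjTranspose, Matrix.neg_mul, Matrix.mul_neg, Matrix.mul_assoc]
    · by_cases hk : (H k).trace = 0
      · left
        rw [skewTilde, Matrix.trace_mul_comm, ← Matrix.mul_assoc, unitary_mul_conjTranspose,
          Matrix.one_mul, skew, Matrix.trace_neg, Matrix.trace_smul, hk, smul_zero, neg_zero]
      · exact Or.inr ⟨k, hk⟩
  have h3 : gramian H T X N = ∫ t in (0 : ℝ)..T, ∑ k, (trace (Eᴴ * skewTilde (H k) (X t) *
      (Y 0 : Matrix (Fin n) (Fin n) ℂ) * E)).re ^ 2 := by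
    rw [gramian]
    simp only [hNrep _ (hmem _ _)]
  rw [← h3] at h2
  have h4 : g * C₁ / C₂ * lyapunov E (Y 0 : Matrix (Fin n) (Fin n) ℂ) ≤
      lyapunov E (Y 0 : Matrix (Fin n) (Fin n) ℂ) - lyapunov E (Y T : Matrix (Fin n) (Fin n) ℂ) := by
    rw [div_mul_eq_mul_div, div_le_iff₀ hC₂]
    have := mul_le_mul_of_nonneg_left hNlow hg.le
    linarith
  have h5 := mul_le_mul_of_nonneg_right (le_max_left (1 - g * C₁ / C₂) (1 / 2)) hV
  linarith

end Decrease

/-! ### Zero sets of polynomials -/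

section NullSets

/-- Induction on the number of variables by Fubini. As a polynomial in the first variable, `Q` has
some nonzero coefficient; for almost all values of the others this coefficient does not vanish, and
only finitely many roots remain. -/
theorem ae_eval_ne_zero_fin (n : ℕ) (Q : MvPolynomial (Fin n) ℝ) (hQ : Q ≠ 0) :
    ∀ᵐ v : Fin n → ℝ, MvPolynomial.eval v Q ≠ 0 := by
  induction n with
  | zero =>
    refine Filter.Eventually.of_forall fun v hv => hQ ?_
    refine MvPolynomial.funext fun x => ?_
    rw [Subsingleton.elim x v, hv, map_zero]
  | succ n ih =>
    let F := MvPolynomial.finSuccEquiv ℝ n Q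
    have hF : F ≠ 0 := fun h => hQ ((MvPolynomial.finSuccEquiv ℝ n).injective (by simpa [F] using h))
    obtain ⟨i, hi⟩ : ∃ i, F.coeff i ≠ 0 := by
      by_contra! hcon
      exact hF (Polynomial.ext fun i => by simpa using hcon i)
    let L : (Fin n → ℝ) × ℝ →ₗ[ℝ] Fin (n + 1) → ℝ :=
      { toFun := fun p => Fin.cons p.2 p.1
        map_add' := fun p q => by
          ext j
          refine Fin.cases ?_ (fun j => ?_) j <;> simp
        map_smul' := fun c p => by
          ext j
          refine Fin.cases ?_ (fun j => ?_) j <;> simp }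
    have hL : Function.Surjective L := fun v =>
      ⟨(Fin.tail v, v 0), Fin.cons_self_tail v⟩
    have hmeas : MeasurableSet {v : Fin (n + 1) → ℝ | MvPolynomial.eval v Q ≠ 0} :=
      ((MvPolynomial.continuous_eval Q).measurable (measurableSet_singleton 0)).compl
    have : (volume : Measure ((Fin n → ℝ) × ℝ)).IsAddHaarMeasure := by
      rw [Measure.volume_eq_prod]
      infer_instance
    refine (ae_comp_linearMap_mem_iff L volume volume hL hmeas).1 ?_
    have hLm : Measurable L := L.continuous_of_finiteDimensional.measurable
    rw [ae_iff]
    have hs : MeasurableSet {p : (Fin n → ℝ) × ℝ |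
        ¬ L p ∈ {v : Fin (n + 1) → ℝ | MvPolynomial.eval v Q ≠ 0}} := (hLm hmeas).compl
    rw [Measure.volume_eq_prod, Measure.measure_prod_null hs]
    filter_upwards [ih (F.coeff i) hi] with x hx
    have hpoly : F.map (MvPolynomial.eval x) ≠ 0 := fun h => hx (by
      have := congrArg (fun p => Polynomial.coeff p i) h
      simpa using this)
    refine Set.Finite.measure_zero (Set.Finite.subset
      (F.map (MvPolynomial.eval x)).roots.toFinset.finite_toSet fun y hy => ?_) _
    have hy' : MvPolynomial.eval (Fin.cons y x : Fin (n + 1) → ℝ) Q = 0 := by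
      by_contra h
      exact hy h
    rw [MvPolynomial.eval_eq_eval_mv_eval'] at hy'
    simpa [hpoly] using hy'

/-- The zero set of a nonzero polynomial is a null set. -/
theorem ae_eval_ne_zero {σ : Type*} [Fintype σ] (Q : MvPolynomial σ ℝ) (hQ : Q ≠ 0) :
    ∀ᵐ v : σ → ℝ, MvPolynomial.eval v Q ≠ 0 := by
  let e := Fintype.equivFin σ
  let L : (σ → ℝ) →ₗ[ℝ] Fin (Fintype.card σ) → ℝ := LinearMap.funLeft ℝ ℝ e.symm
  have hL : Function.Surjective L := LinearMap.funLeft_surjective_of_injective ℝ ℝ _ e.symm.injective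
  have hQ' : MvPolynomial.rename e Q ≠ 0 := fun h =>
    hQ (MvPolynomial.rename_injective e e.injective (by rw [h, map_zero]))
  have hmeas : MeasurableSet {v : Fin (Fintype.card σ) → ℝ |
      MvPolynomial.eval v (MvPolynomial.rename e Q) ≠ 0} :=
    ((MvPolynomial.continuous_eval _).measurable (measurableSet_singleton 0)).compl
  have h := (ae_comp_linearMap_mem_iff L volume volume hL hmeas).2
    (ae_eval_ne_zero_fin _ _ hQ')
  filter_upwards [h] with v hv
  have hv' : MvPolynomial.eval (L v) (MvPolynomial.rename e Q) ≠ 0 := hv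
  rw [MvPolynomial.eval_rename] at hv'
  have : L v ∘ e = v := by
    ext1 i
    simp [L, LinearMap.funLeft]
  rwa [this] at hv'

end NullSets

/-! ### Jets of random seeds -/

section Seeds

/-- Writing sine and cosine as real linear images of one complex exponential turns differentiation
into multiplication by `i ω`, and treats both at once. -/
theorem iteratedDerivWithin_clm_exp {T : ℝ} (hT : 0 < T) (φ : ℂ →L[ℝ] ℝ) (ω : ℝ) (j : ℕ) :
    ∀ t ∈ Icc 0 T, iteratedDerivWithin j (fun t : ℝ => φ (Complex.exp (Complex.I * ω * t)))
      (Icc 0 T) t = φ ((Complex.I * ω) ^ j * Complex.exp (Complex.I * ω * t)) := by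
  induction j with
  | zero => simp
  | succ j ih =>
    intro t ht
    rw [iteratedDerivWithin_succ, derivWithin_congr ih (ih t ht)]
    have h1 : HasDerivAt (fun t : ℝ => Complex.I * ω * (t : ℂ)) (Complex.I * ω) t := by
      simpa using (Complex.ofRealCLM.hasDerivAt (x := t)).const_mul (Complex.I * (ω : ℂ))
    have h2 := φ.hasFDerivAt.comp_hasDerivAt t (h1.cexp.const_mul ((Complex.I * ω) ^ j))
    refine (h2.hasDerivWithinAt.derivWithin (uniqueDiffOn_Icc hT t ht)).trans ?_
    congr 1
    ring

theorem contDiff_clm_exp (φ : ℂ →L[ℝ] ℝ) (ω : ℝ) {N : WithTop ℕ∞} :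
    ContDiff ℝ N fun t : ℝ => φ (Complex.exp (Complex.I * ω * t)) :=
  φ.contDiff.comp (contDiff_const.mul Complex.ofRealCLM.contDiff).cexp

/-- The polynomial that describes the derivative of order `j` of the product of an exponential with
a function whose derivatives are the `W i`. -/
def leibnizPoly (W : ℕ → ℝ) (j : ℕ) : Polynomial ℝ :=
  ∑ i ∈ Finset.range (j + 1), Polynomial.C (j.choose i * W i) * Polynomial.X ^ (j - i)

/-- Only the term in which the window is not differentiated reaches degree `j`, with coefficient `W
0`. This is why the window must be nonzero at the chosen time. -/
theorem degree_leibnizPoly {W : ℕ → ℝ} (hW : W 0 ≠ 0) (j : ℕ) :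
    (leibnizPoly W j).degree = j := by
  refine le_antisymm ?_ (Polynomial.le_degree_of_ne_zero ?_)
  · refine (Polynomial.degree_sum_le _ _).trans (Finset.sup_le fun i _ => ?_)
    exact (Polynomial.degree_C_mul_X_pow_le _ _).trans (by exact_mod_cast Nat.sub_le j i)
  · rw [leibnizPoly, Polynomial.finsetSum_coeff, Finset.sum_eq_single 0]
    · simpa using hW
    · intro i hi hi0
      rw [Finset.mem_range] at hi
      rw [Polynomial.coeff_C_mul_X_pow, if_neg (by omega)]
    · simp

theorem linearIndependent_leibnizPoly {W : ℕ → ℝ} (hW : W 0 ≠ 0) :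
    LinearIndependent ℝ (leibnizPoly W) :=
  Polynomial.Sequence.linearIndependent ⟨leibnizPoly W, degree_leibnizPoly hW⟩

theorem iteratedDerivWithin_mul_clm_exp {T : ℝ} (hT : 0 < T) {M : ℕ} {w : ℝ → ℝ}
    (hw : ContDiffOn ℝ M w (Icc 0 T)) (φ : ℂ →L[ℝ] ℝ) (ω : ℝ) {j : ℕ} (hj : j ≤ M) {t : ℝ}
    (ht : t ∈ Icc 0 T) :
    iteratedDerivWithin j (fun t : ℝ => w t * φ (Complex.exp (Complex.I * ω * t))) (Icc 0 T) t =
      φ (Polynomial.aeval (Complex.I * ω)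
        (leibnizPoly (fun i => iteratedDerivWithin i w (Icc 0 T) t) j) *
          Complex.exp (Complex.I * ω * t)) := by
  have h := iteratedDerivWithin_mul (n := j) ht (uniqueDiffOn_Icc hT)
    ((hw t ht).of_le (by exact_mod_cast hj))
    (contDiff_clm_exp φ ω (N := j)).contDiffWithinAt
  refine h.trans ?_
  rw [leibnizPoly, map_sum, Finset.sum_mul, map_sum]
  refine Finset.sum_congr rfl fun i _ => ?_
  rw [iteratedDerivWithin_clm_exp hT φ ω (j - i) t ht, map_mul (Polynomial.aeval _), Polynomial.aeval_C,
    map_pow, Polynomial.aeval_X, mul_assoc, Complex.coe_algebraMap, ← Complex.real_smul, smul_mul_assoc,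
    map_smul, smul_eq_mul]
  ring

/-- A combination of Leibniz polynomials that vanishes at many pairs of conjugate imaginary numbers
is trivial. -/
theorem coeff_eq_zero_of_aeval_leibnizPoly {W : ℕ → ℝ} (hW : W 0 ≠ 0) {M₀ M : ℕ} (hM₀ : 1 ≤ M₀)
    (hM : M₀ ≤ M) {ω : Fin M → ℝ} (hω : Function.Injective ω) (hpos : ∀ l, 0 < ω l)
    {c : Fin (M₀ + 1) → ℝ}
    (h : ∀ l, Polynomial.aeval (Complex.I * ω l) (∑ j, c j • leibnizPoly W (j : ℕ)) = 0) :
    ∀ j, c j = 0 := by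
  set q := ∑ j, c j • leibnizPoly W (j : ℕ) with hq
  have hdeg : q.natDegree ≤ M₀ := by
    refine Polynomial.natDegree_sum_le_of_forall_le _ _ fun j _ => ?_
    refine (Polynomial.natDegree_smul_le _ _).trans ?_
    rw [Polynomial.natDegree_eq_of_degree_eq_some (degree_leibnizPoly hW j)]
    omega
  -- The polynomial is real, so the conjugates of its roots are roots. This yields `2 M` distinct
  -- roots, more than the degree bound `M₀`, because `1 ≤ M₀ ≤ M`.
  let f : Fin M ⊕ Fin M → ℂ := Sum.elim (fun l => Complex.I * ω l) fun l => -(Complex.I * ω l)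
  have him : ∀ l, (Complex.I * (ω l : ℂ)).im = ω l := fun l => by simp
  have hf : Function.Injective f := by
    rintro (l | l) (l' | l') hll
    all_goals
      have h1 := congrArg Complex.im hll
      simp only [f, Sum.elim_inl, Sum.elim_inr, Complex.neg_im, him] at h1
      have := hpos l
      have := hpos l'
    · rw [hω h1]
    · linarith
    · linarith
    · rw [hω (neg_injective h1)]
  have hzero : q.map (algebraMap ℝ ℂ) = 0 := by
    refine Polynomial.eq_zero_of_natDegree_lt_card_of_eval_eq_zero _ hf ?_ ?_
    · rintro (l | l)
      · simpa [f, Polynomial.eval_map_algebraMap] using h l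
      · have h1 := congrArg (starRingEnd ℂ) (h l)
        rw [map_zero, ← Polynomial.aeval_conj] at h1
        simpa [f, Polynomial.eval_map_algebraMap] using h1
    · rw [Fintype.card_sum, Fintype.card_fin]
      exact lt_of_le_of_lt Polynomial.natDegree_map_le (by omega)
  have hq0 : q = 0 := (Polynomial.map_eq_zero (algebraMap ℝ ℂ)).1 hzero
  exact Fintype.linearIndependent_iff.1
    ((linearIndependent_leibnizPoly hW).comp (fun j : Fin (M₀ + 1) => (j : ℕ))
      Fin.val_injective) c hq0

variable {m M : ℕ}

/-- The angular frequency of the harmonic `l + 1` of period `P`. -/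
def frequency (P : ℝ) (l : Fin M) : ℝ := 2 * ((l : ℕ) + 1 : ℝ) * Real.pi / P

/-- The jet of a seed as a linear function of the coefficients. -/
def seedJet (m M M₀ : ℕ) (T : ℝ) (w : ℝ → ℝ) (P t : ℝ) :
    (Fin m → Fin M → ℝ) × (Fin m → Fin M → ℝ) →ₗ[ℝ] (Fin m × Fin (M₀ + 1) → ℝ) where
  toFun ab p := ∑ l : Fin M,
    (ab.1 p.1 l * iteratedDerivWithin p.2
        (fun t : ℝ => w t * Complex.imCLM (Complex.exp (Complex.I * frequency P l * t)))
        (Icc 0 T) t +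
      ab.2 p.1 l * iteratedDerivWithin p.2
        (fun t : ℝ => w t * Complex.reCLM (Complex.exp (Complex.I * frequency P l * t)))
        (Icc 0 T) t)
  map_add' x y := by
    ext1 p
    simp only [Prod.fst_add, Prod.snd_add, Pi.add_apply, ← Finset.sum_add_distrib]
    refine Finset.sum_congr rfl fun l _ => ?_
    ring
  map_smul' c x := by
    ext1 p
    simp only [Prod.smul_fst, Prod.smul_snd, Pi.smul_apply, smul_eq_mul, RingHom.id_apply,
      Finset.mul_sum]
    refine Finset.sum_congr rfl fun l _ => ?_
    ring

theorem seedInput_eq (w : ℝ → ℝ) (P : ℝ) (ab : (Fin m → Fin M → ℝ) × (Fin m → Fin M → ℝ))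
    (k : Fin m) :
    seedInput w P ab k = fun t => ∑ l : Fin M,
      (ab.1 k l * (w t * Complex.imCLM (Complex.exp (Complex.I * frequency P l * t))) +
        ab.2 k l * (w t * Complex.reCLM (Complex.exp (Complex.I * frequency P l * t)))) := by
  ext1 t
  rw [seedInput, Finset.mul_sum]
  refine Finset.sum_congr rfl fun l _ => ?_
  have harg : Complex.I * (frequency P l : ℂ) * (t : ℂ) =
      ((2 * ((l : ℕ) + 1 : ℝ) * Real.pi * t / P : ℝ) : ℂ) * Complex.I := by
    rw [mul_assoc, ← Complex.ofReal_mul, mul_comm, frequency, div_mul_eq_mul_div]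
  rw [harg, Complex.imCLM_apply, Complex.reCLM_apply, Complex.exp_ofReal_mul_I_im,
    Complex.exp_ofReal_mul_I_re]
  ring

theorem inputJet_seedInput {M₀ : ℕ} {T : ℝ} (hT : 0 < T) {w : ℝ → ℝ}
    (hw : ContDiffOn ℝ M₀ w (Icc 0 T)) (P : ℝ) {t : ℝ} (ht : t ∈ Icc 0 T)
    (ab : (Fin m → Fin M → ℝ) × (Fin m → Fin M → ℝ)) :
    inputJet M₀ T (seedInput w P ab) t = seedJet m M M₀ T w P t ab := by
  ext1 p
  have hp : ((p.2 : ℕ) : WithTop ℕ∞) ≤ (M₀ : WithTop ℕ∞) := by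
    exact_mod_cast Nat.lt_succ_iff.1 p.2.2
  have hc : ∀ (φ : ℂ →L[ℝ] ℝ) (ω : ℝ), ContDiffWithinAt ℝ (p.2 : ℕ)
      (fun t : ℝ => w t * φ (Complex.exp (Complex.I * ω * t))) (Icc 0 T) t := fun φ ω =>
    ((hw t ht).of_le hp).mul (contDiff_clm_exp φ ω).contDiffWithinAt
  have hu := uniqueDiffOn_Icc hT
  rw [inputJet, seedInput_eq, iteratedDerivWithin_fun_sum ht hu fun l _ =>
    (contDiffWithinAt_const.mul (hc _ _)).add (contDiffWithinAt_const.mul (hc _ _))]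
  refine Finset.sum_congr rfl fun l _ => ?_
  rw [iteratedDerivWithin_fun_add ht hu (contDiffWithinAt_const.mul (hc _ _))
    (contDiffWithinAt_const.mul (hc _ _)), iteratedDerivWithin_const_mul ht hu _ (hc _ _),
    iteratedDerivWithin_const_mul ht hu _ (hc _ _)]

/-- A nonzero linear form vanishing on the range would give, for each input, a real combination of
the `leibnizPoly W j`, `j ≤ M₀`, that vanishes at `i ω` for all frequencies; these combinations are
trivial by the root count. -/
theorem seedJet_surjective {M₀ : ℕ} (hM₀ : 1 ≤ M₀) (hM : M₀ ≤ M) {T P : ℝ} (hT : 0 < T)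
    (hP : 0 < P) {w : ℝ → ℝ} (hw : ContDiffOn ℝ M₀ w (Icc 0 T)) {t : ℝ} (ht : t ∈ Icc 0 T)
    (hwt : w t ≠ 0) : Function.Surjective (seedJet m M M₀ T w P t) := by
  classical
  rw [← LinearMap.range_eq_top]
  by_contra hne
  obtain ⟨f, hf0, hf⟩ := Submodule.exists_le_ker_of_lt_top _ (lt_top_iff_ne_top.2 hne)
  set W : ℕ → ℝ := fun i => iteratedDerivWithin i w (Icc 0 T) t with hWdef
  have hW : W 0 ≠ 0 := by simpa [W] using hwt
  let c : Fin m × Fin (M₀ + 1) → ℝ := fun p => f (Pi.single p 1)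
  have hfc : ∀ x, f x = ∑ p, x p * c p := by
    intro x
    conv_lhs => rw [← Finset.univ_sum_single x, map_sum]
    refine Finset.sum_congr rfl fun p _ => ?_
    have : (Pi.single p (x p) : Fin m × Fin (M₀ + 1) → ℝ) = x p • Pi.single p 1 := by
      rw [← Pi.single_smul, smul_eq_mul, mul_one]
    rw [this, map_smul, smul_eq_mul]
  have hvan : ∀ ab, ∑ p, seedJet m M M₀ T w P t ab p * c p = 0 := fun ab => by
    rw [← hfc]
    exact hf ⟨ab, rfl⟩
  have hconv : ∀ (φ : ℂ →L[ℝ] ℝ) (k : Fin m) (l : Fin M),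
      ∑ j : Fin (M₀ + 1), iteratedDerivWithin j
        (fun t : ℝ => w t * φ (Complex.exp (Complex.I * frequency P l * t))) (Icc 0 T) t *
          c (k, j) =
      φ (Polynomial.aeval (Complex.I * frequency P l)
        (∑ j : Fin (M₀ + 1), c (k, j) • leibnizPoly W (j : ℕ)) *
          Complex.exp (Complex.I * frequency P l * t)) := by
    intro φ k l
    rw [map_sum, Finset.sum_mul, map_sum]
    refine Finset.sum_congr rfl fun j _ => ?_
    rw [iteratedDerivWithin_mul_clm_exp hT hw φ _ (Nat.lt_succ_iff.1 j.2) ht, map_smul,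
      smul_mul_assoc, map_smul, smul_eq_mul, mul_comm]
  have hsum : ∀ (k : Fin m) (l : Fin M) (g : Fin (M₀ + 1) → Fin M → ℝ),
      ∑ p : Fin m × Fin (M₀ + 1),
        (∑ l', (Pi.single k (Pi.single l 1) : Fin m → Fin M → ℝ) p.1 l' * g p.2 l') * c p =
          ∑ j, g j l * c (k, j) := by
    intro k l g
    rw [Fintype.sum_prod_type, Finset.sum_eq_single k]
    · refine Finset.sum_congr rfl fun j _ => ?_
      rw [Finset.sum_eq_single l]
      · simp
      · intro l' _ hl'
        simp [hl']
      · simp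
    · intro k' _ hk'
      simp [hk']
    · simp
  have hroot : ∀ (k : Fin m) (l : Fin M), Polynomial.aeval (Complex.I * frequency P l)
      (∑ j : Fin (M₀ + 1), c (k, j) • leibnizPoly W (j : ℕ)) = 0 := by
    intro k l
    have him : Complex.imCLM (Polynomial.aeval (Complex.I * frequency P l)
        (∑ j : Fin (M₀ + 1), c (k, j) • leibnizPoly W (j : ℕ)) *
          Complex.exp (Complex.I * frequency P l * t)) = 0 := by
      rw [← hconv]
      have h := hvan (Pi.single k (Pi.single l 1), 0)
      simp only [seedJet, LinearMap.coe_mk, AddHom.coe_mk, Pi.zero_apply, zero_mul, add_zero] at h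
      exact (hsum k l fun j l => iteratedDerivWithin j (fun t : ℝ => w t *
        Complex.imCLM (Complex.exp (Complex.I * frequency P l * t))) (Icc 0 T) t).symm.trans h
    have hre : Complex.reCLM (Polynomial.aeval (Complex.I * frequency P l)
        (∑ j : Fin (M₀ + 1), c (k, j) • leibnizPoly W (j : ℕ)) *
          Complex.exp (Complex.I * frequency P l * t)) = 0 := by
      rw [← hconv]
      have h := hvan (0, Pi.single k (Pi.single l 1))
      simp only [seedJet, LinearMap.coe_mk, AddHom.coe_mk, Pi.zero_apply, zero_mul, zero_add] at h
      exact (hsum k l fun j l => iteratedDerivWithin j (fun t : ℝ => w t *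
        Complex.reCLM (Complex.exp (Complex.I * frequency P l * t))) (Icc 0 T) t).symm.trans h
    -- The sine coefficients give the imaginary part and the cosine coefficients the real part of
    -- one complex equation, whose exponential factor never vanishes.
    exact (mul_eq_zero.1 (Complex.ext hre him)).resolve_right (Complex.exp_ne_zero _)
  have hpos : ∀ l : Fin M, 0 < frequency P l := fun l => by
    rw [frequency]
    positivity
  have hinj : Function.Injective (frequency P : Fin M → ℝ) := by
    intro l l' h
    rw [frequency, frequency, div_left_inj' hP.ne', mul_left_inj' Real.pi_ne_zero,
      mul_right_inj' two_ne_zero, add_left_inj] at h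
    exact Fin.ext (by exact_mod_cast h)
  refine hf0 (LinearMap.ext fun x => ?_)
  rw [hfc]
  refine Finset.sum_eq_zero fun p _ => ?_
  rw [coeff_eq_zero_of_aeval_leibnizPoly hW hM₀ hM hinj hpos (hroot p.1) p.2, mul_zero]

/-- Almost no seed solves a given nontrivial differential equation. -/
theorem ae_not_solvesDiffPoly {M₀ : ℕ} (hM₀ : 1 ≤ M₀) (hM : M₀ ≤ M)
    {Q : MvPolynomial (Fin m × Fin (M₀ + 1)) ℝ} (hQ : Q ≠ 0) {T P : ℝ} (hT : 0 < T) (hP : 0 < P)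
    {w : ℝ → ℝ} (hw : ContDiffOn ℝ M₀ w (Icc 0 T)) {t : ℝ} (ht : t ∈ Icc 0 T) (hwt : w t ≠ 0) :
    ∀ᵐ ab : (Fin m → Fin M → ℝ) × (Fin m → Fin M → ℝ),
      ¬ SolvesDiffPoly Q T (seedInput w P ab) := by
  have hmeas : MeasurableSet {v : Fin m × Fin (M₀ + 1) → ℝ | MvPolynomial.eval v Q ≠ 0} :=
    ((MvPolynomial.continuous_eval Q).measurable (measurableSet_singleton 0)).compl
  have : (volume : Measure (Fin m → Fin M → ℝ)).IsAddHaarMeasure :=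
    Measure.pi.isAddHaarMeasure _
  have : (volume : Measure ((Fin m → Fin M → ℝ) × (Fin m → Fin M → ℝ))).IsAddHaarMeasure :=
    Measure.prod.instIsAddHaarMeasure _ _
  have h := (ae_comp_linearMap_mem_iff (seedJet m M M₀ T w P t) volume volume
    (seedJet_surjective hM₀ hM hT hP hw ht hwt) hmeas).2 (ae_eval_ne_zero Q hQ)
  filter_upwards [h] with ab hab hsol
  refine hab ?_
  rw [← inputJet_seedInput hT hw P ht]
  exact hsol t ht

end Seeds

end QuantumControl

end

open QuantumControl

theorem mainTheorem3 (n m : ℕ) (H₀ : Matrix (Fin n) (Fin n) ℂ)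
    (H : Fin m → Matrix (Fin n) (Fin n) ℂ) (hH₀ : H₀.IsHermitian)
    (hH : ∀ k, (H k).IsHermitian) (hctrl : Controllable H₀ H) :
    ∃ (M₀ : ℕ) (Q : MvPolynomial (Fin m × Fin (M₀ + 1)) ℝ), Q ≠ 0 ∧
      -- attractivity of every reference input that does not solve the equation
      (∀ (d : ℕ) (E : Matrix (Fin n) (Fin d) ℂ), Eᴴ * E = 1 →
        (d < n ∨ ∃ k, (H k).trace ≠ 0) →
        ∀ K c T_f : ℝ, 0 < K → 0 < c → c < 2 → 0 < T_f →
          (∀ u : Fin m → ℝ → ℝ, (∀ k, ContDiffOn ℝ M₀ (u k) (Icc 0 T_f)) →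
            ¬ SolvesDiffPoly Q T_f u → UniformlyAttractive H₀ H E K T_f c u) ∧
          -- probability one with respect to the jet of the reference input
          (∀ (μ : Measure (Fin m × Fin (M₀ + 1) → ℝ)), IsProbabilityMeasure μ → μ ≪ volume →
            ∀ᵐ v ∂μ, ∀ t₀ ∈ Icc 0 T_f, ∀ u : Fin m → ℝ → ℝ,
              (∀ k, ContDiffOn ℝ M₀ (u k) (Icc 0 T_f)) → inputJet M₀ T_f u t₀ = v →
              UniformlyAttractive H₀ H E K T_f c u)) ∧
      -- random seeds
      (∀ T_f P : ℝ, 0 < T_f → 0 < P → ∀ M : ℕ, M₀ ≤ M →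
        ∀ w : ℝ → ℝ, ContDiffOn ℝ M₀ w (Icc 0 T_f) → (∃ t ∈ Icc 0 T_f, w t ≠ 0) →
        ∀ μ : Measure ((Fin m → Fin M → ℝ) × (Fin m → Fin M → ℝ)),
          IsProbabilityMeasure μ → μ ≪ volume →
          ∀ᵐ ab ∂μ, ¬ SolvesDiffPoly Q T_f (seedInput w P ab)) := by
  obtain ⟨M₀, Q, hM₀, hQ, hobs⟩ := exists_observability_polynomial hH₀ hH hctrl
  refine ⟨M₀, Q, hQ, ?_, ?_⟩
  · intro d E hE hd K c T hK hc0 hc hT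
    have key : ∀ u : Fin m → ℝ → ℝ, (∀ k, ContDiffOn ℝ M₀ (u k) (Icc 0 T)) →
        ∀ t₀ ∈ Icc 0 T, MvPolynomial.eval (inputJet M₀ T u t₀) Q ≠ 0 →
          UniformlyAttractive H₀ H E K T c u := by
      intro u hu t₀ ht₀ hne
      refine uniformlyAttractive_of_observable hH₀ hH hE hd hK hc0 hc hT ?_
      intro X₀ X hX N hN hNs
      obtain ⟨h1, h2⟩ := conj_mem_skewSpace (X t₀) hNs
      -- The test matrix `X N X†` conjugates back to `N`, so the form evaluates to `Re tr (N N)`,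
      -- which is `-frob N` for skew-Hermitian `N`.
      have h := hobs T hT u hu t₀ ht₀ hne X₀ X hX N hN _ h1 h2
      have hconj : conjMap (X t₀ : Matrix (Fin n) (Fin n) ℂ)
          ((X t₀ : Matrix (Fin n) (Fin n) ℂ) * N * (X t₀ : Matrix (Fin n) (Fin n) ℂ)ᴴ) = N := by
        rw [conjMap_apply, ← Matrix.mul_assoc, ← Matrix.mul_assoc, unitary_conjTranspose_mul,
          Matrix.one_mul, Matrix.mul_assoc, unitary_conjTranspose_mul, Matrix.mul_one]
      rw [hconj, traceForm_apply] at h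
      refine frob_eq_zero ?_
      rw [frob_eq_trace, hNs.1, Matrix.neg_mul, Matrix.trace_neg, Complex.neg_re, h, neg_zero]
    refine ⟨fun u hu hsol => ?_, fun μ _ hμ => ?_⟩
    · rw [SolvesDiffPoly] at hsol
      push Not at hsol
      obtain ⟨t₀, ht₀, hne⟩ := hsol
      exact key u hu t₀ ht₀ hne
    · filter_upwards [hμ.ae_le (ae_eval_ne_zero Q hQ)] with v hv t₀ ht₀ u hu hjet
      exact key u hu t₀ ht₀ (by rwa [hjet])
  · rintro T P hT hP M hM w hw ⟨t, ht, hwt⟩ μ _ hμ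
    exact hμ.ae_le (ae_not_solvesDiffPoly hM₀ hM hQ hT hP hw ht hwt)
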